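/- Let $n\ge 1$ and let $M$ be a complex manifold of complex dimension $n$ (Hausdorff and second countable) with a Kähler form $\omega$ and a nowhere vanishing holomorphic $(n,0)$-form $\varphi$. Assume that $H^1(M,\mathbb R)=0$. Let the torus $T=T^{n-1}$, with Lie algebra $\mathcal G\cong\mathbb R^{n-1}$, act smoothly on $M$ by biholomorphisms preserving $\omega$ and $\varphi$. For $v\in\mathcal G$ let $X_v$ be the induced vector field on $M$, and suppose that the action has a moment map $\mu:M\to\mathcal G^*$, that is, a smooth map with $d(\mu(v))=i_{X_v}\omega$ for all $v\in\mathcal G$. Fix a basis $v_1,\dots,v_{n-1}$ of $\mathcal G$, which identifies $\mathcal G^*$ with $\mathbb R^{n-1}$, and let $\varphi'$ be the 1-form $i_{X_{v_1}}\cdots i_{X_{v_{n-1}}}\varphi$. Call a point $x\in M$ non-regular if the linear map $v\mapsto X_v(x)$ is not injective. Suppose that the set of non-regular points is a finite union $S=\bigcup_i S_i$ of connected (embedded) smooth submanifolds $S_i$ of $M$, such that for each $i$ the subgroup $T_i\subset T$ of elements fixing every point of $S_i$ has positive dimension. Then there is a holomorphic function $f:M\to\mathbb C$ with $df=\varphi'$.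 Moreover, for every such $f$, with $\xi=\operatorname{Im} f$, there is a finite union $H=\bigcup_j H_j$ of affine $(n-2)$-dimensional planes $H_j\subset\mathbb R^n$ such that for every $p\in\mathbb R^n\setminus H$ the fiber $L=(\mu,\xi)^{-1}(p)$ is a smooth special Lagrangian submanifold of $M$: it is (possibly empty) an embedded smooth submanifold of real dimension $n$ with $\omega|_L=0$ and $\operatorname{Im}\varphi|_L=0$. -/

import Mathlib

open scoped Manifold ContDiff Topology

noncomputable section

namespace CalabiYauTorus

/-! Throughout, a complex manifold `M` is modelled on a finite-dimensional complex vector space `E`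
by a complex analytic atlas. The same charts make it a real smooth manifold, both
`TangentSpace 𝓘(ℂ, E) x` and `TangentSpace 𝓘(ℝ, E) x` being `E` (in the preferred chart at `x`), and
the complex structure on the tangent space is multiplication by `Complex.I` on `E`. -/

section Forms

variable (𝕜 : Type*) [NontriviallyNormedField 𝕜]
  {E : Type*} [NormedAddCommGroup E] [NormedSpace 𝕜 E]
  {M : Type*} [TopologicalSpace M] [ChartedSpace E M]
  {F : Type*} [NormedAddCommGroup F] [NormedSpace 𝕜 F] {r : ℕ}

/-- The coordinate expression of an `r`-form in a chart `e`: its pullback by `e.symm`. It is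
meaningful on `e.target`. -/
def chartRep (e : OpenPartialHomeomorph M E)
    (α : (x : M) → TangentSpace 𝓘(𝕜, E) x [⋀^Fin r]→L[𝕜] F) :
    E → E [⋀^Fin r]→L[𝕜] F :=
  fun y => (α (e.symm y)).compContinuousLinearMap (mfderiv 𝓘(𝕜, E) 𝓘(𝕜, E) e.symm y)

end Forms

section

variable {E : Type*} [NormedAddCommGroup E] [NormedSpace ℂ E]
  {M : Type*} [TopologicalSpace M] [ChartedSpace E M]

/-- A smooth real `r`-form. -/
def IsSmoothForm {r : ℕ} (α : (x : M) → TangentSpace 𝓘(ℝ, E) x [⋀^Fin r]→L[ℝ] ℝ) : Prop :=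
  ∀ e ∈ atlas E M, ContDiffOn ℝ ∞ (chartRep ℝ e α) e.target

/-- A closed real `r`-form: the exterior derivative vanishes in every chart. -/
def IsClosedForm {r : ℕ} (α : (x : M) → TangentSpace 𝓘(ℝ, E) x [⋀^Fin r]→L[ℝ] ℝ) : Prop :=
  ∀ e ∈ atlas E M, ∀ y ∈ e.target, extDeriv (chartRep ℝ e α) y = 0

variable (E M) in
/-- `H¹(M, ℝ) = 0` in de Rham cohomology: every smooth closed real 1-form is the differential of a
smooth function. -/
def H1Vanishes : Prop :=
  ∀ α : (x : M) → TangentSpace 𝓘(ℝ, E) x [⋀^Fin 1]→L[ℝ] ℝ, IsSmoothForm α → IsClosedForm α →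
    ∃ h : M → ℝ, ContMDiff 𝓘(ℝ, E) 𝓘(ℝ, ℝ) ∞ h ∧
      ∀ (x : M) (w : TangentSpace 𝓘(ℝ, E) x), mfderiv 𝓘(ℝ, E) 𝓘(ℝ, ℝ) h x w = α x ![w]

/-- Multiplication by `i` on the tangent space. -/
def J (x : M) (w : TangentSpace 𝓘(ℝ, E) x) : TangentSpace 𝓘(ℝ, E) x :=
  (fun z : E => Complex.I • z) w

/-- `κ` is a Kähler form: a smooth closed real 2-form of type (1,1) such that `κ(w, Jw)` is the
square norm of a (Riemannian) metric. -/
structure IsKahlerForm (κ : (x : M) → TangentSpace 𝓘(ℝ, E) x [⋀^Fin 2]→L[ℝ] ℝ) : Prop where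
  smooth : IsSmoothForm κ
  closed : IsClosedForm κ
  invariant : ∀ (x : M) (u w : TangentSpace 𝓘(ℝ, E) x), κ x ![J x u, J x w] = κ x ![u, w]
  pos : ∀ (x : M) (w : TangentSpace 𝓘(ℝ, E) x), w ≠ 0 → 0 < κ x ![w, J x w]

/-- `φ` is a nowhere vanishing holomorphic `(n,0)`-form: a field of `ℂ`-multilinear alternating
`n`-forms, whose coordinate expressions are holomorphic. -/
structure IsHolomorphicVolumeForm {n : ℕ}
    (φ : (x : M) → TangentSpace 𝓘(ℂ, E) x [⋀^Fin n]→L[ℂ] ℂ) : Prop where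
  holomorphic : ∀ e ∈ atlas E M, AnalyticOnNhd ℂ (chartRep ℂ e φ) e.target
  ne_zero : ∀ x : M, φ x ≠ 0

/-- `S` is a smooth (embedded) submanifold of `M` of real dimension `d`: around each of its points
there is a smooth chart of `M` that turns `S` into a `d`-dimensional (affine) subspace. -/
def IsSubmanifold (d : ℕ) (S : Set M) : Prop :=
  ∀ x ∈ S, ∃ e ∈ IsManifold.maximalAtlas 𝓘(ℝ, E) ∞ M, x ∈ e.source ∧
    ∃ V : Submodule ℝ E, Module.finrank ℝ V = d ∧ ∀ y ∈ e.source, y ∈ S ↔ e y - e x ∈ V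

/-- The vectors tangent to `S` at `x`: the velocities at time `0` of the smooth curves that lie in
`S` and are at `x` at time `0`. -/
def tangentVectors (S : Set M) (x : M) : Set (TangentSpace 𝓘(ℝ, E) x) :=
  {w | ∃ γ : ℝ → M, γ 0 = x ∧ ContMDiffAt 𝓘(ℝ, ℝ) 𝓘(ℝ, E) ∞ γ 0 ∧ (∀ᶠ t in 𝓝 (0 : ℝ), γ t ∈ S) ∧
    (mfderiv 𝓘(ℝ, ℝ) 𝓘(ℝ, E) γ 0 (1 : ℝ) : E) = w}

/-- A smooth special Lagrangian submanifold: a submanifold of real dimension `n` on which `κ` and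
`Im φ` restrict to zero. -/
structure IsSpecialLagrangian {n : ℕ} (κ : (x : M) → TangentSpace 𝓘(ℝ, E) x [⋀^Fin 2]→L[ℝ] ℝ)
    (φ : (x : M) → TangentSpace 𝓘(ℂ, E) x [⋀^Fin n]→L[ℂ] ℂ) (L : Set M) : Prop where
  submanifold : IsSubmanifold (E := E) n L
  lagrangian : ∀ x ∈ L, ∀ u ∈ tangentVectors (E := E) L x, ∀ w ∈ tangentVectors (E := E) L x,
    κ x ![u, w] = 0
  special : ∀ x ∈ L, ∀ u : Fin n → TangentSpace 𝓘(ℝ, E) x,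
    (∀ i, u i ∈ tangentVectors L x) → (φ x u).im = 0

end

/-! The torus `T^k = (S¹)^k`, with Lie algebra `ℝ^k`. -/

/-- The torus `T^k`. -/
abbrev Torus (k : ℕ) : Type := Fin k → Circle

/-- The exponential map of the torus, which is its universal covering. -/
def torusExp {k : ℕ} (v : Fin k → ℝ) : Torus k := fun j => Circle.exp (v j)

section Action

variable {k : ℕ} {E : Type*} [NormedAddCommGroup E] [NormedSpace ℂ E]
  {M : Type*} [TopologicalSpace M] [ChartedSpace E M] [MulAction (Torus k) M]

variable (k E M) in
/-- The action map `T^k × M → M` is smooth, expressed on the universal cover `ℝ^k × M` of the first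
factor (`torusExp` is a surjective local diffeomorphism). -/
def IsSmoothAction : Prop :=
  ContMDiff (𝓘(ℝ, Fin k → ℝ).prod 𝓘(ℝ, E)) 𝓘(ℝ, E) ∞
    (fun p : (Fin k → ℝ) × M => torusExp p.1 • p.2)

/-- The torus acts by biholomorphisms which preserve `κ` and `φ`. -/
structure IsStructurePreserving {n : ℕ} (k : ℕ) [MulAction (Torus k) M]
    (κ : (x : M) → TangentSpace 𝓘(ℝ, E) x [⋀^Fin 2]→L[ℝ] ℝ)
    (φ : (x : M) → TangentSpace 𝓘(ℂ, E) x [⋀^Fin n]→L[ℂ] ℂ) : Prop where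
  holomorphic : ∀ t : Torus k, MDifferentiable 𝓘(ℂ, E) 𝓘(ℂ, E) (fun x : M => t • x)
  kahler : ∀ (t : Torus k) (x : M) (u : Fin 2 → TangentSpace 𝓘(ℝ, E) x),
    κ (t • x) (fun i => mfderiv 𝓘(ℝ, E) 𝓘(ℝ, E) (fun y : M => t • y) x (u i)) = κ x u
  volume : ∀ (t : Torus k) (x : M) (u : Fin n → TangentSpace 𝓘(ℂ, E) x),
    φ (t • x) (fun i => mfderiv 𝓘(ℂ, E) 𝓘(ℂ, E) (fun y : M => t • y) x (u i)) = φ x u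

/-- The vector field `X_v` induced by an element `v` of the Lie algebra: the velocity at time `0`
of `t ↦ exp(tv) • x`. -/
def flowField (v : Fin k → ℝ) (x : M) : TangentSpace 𝓘(ℝ, E) x :=
  (mfderiv 𝓘(ℝ, ℝ) 𝓘(ℝ, E) (fun t : ℝ => torusExp (t • v) • x) 0 (1 : ℝ) : E)

variable (k E M) in
/-- The non-regular points: the differential `v ↦ X_v(x)` of the action is not injective. -/
def nonRegularSet : Set M :=
  {x | ¬ Function.Injective (fun v : Fin k → ℝ => flowField (E := E) v x)}

/-- A moment map `μ : M → 𝒢*`: a smooth map with `d(μ(v)) = κ(X_v, ·)` for every `v` in `𝒢`. -/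
structure IsMomentMap (κ : (x : M) → TangentSpace 𝓘(ℝ, E) x [⋀^Fin 2]→L[ℝ] ℝ)
    (μ : M → Module.Dual ℝ (Fin k → ℝ)) : Prop where
  smooth : ∀ v : Fin k → ℝ, ContMDiff 𝓘(ℝ, E) 𝓘(ℝ, ℝ) ∞ (fun x => μ x v)
  deriv : ∀ (v : Fin k → ℝ) (x : M) (w : TangentSpace 𝓘(ℝ, E) x),
    mfderiv 𝓘(ℝ, E) 𝓘(ℝ, ℝ) (fun y => μ y v) x w = κ x ![flowField v x, w]

variable (k) in
/-- The stabilizer in `T^k` of all points of `S` (a closed subgroup) has positive dimension: its Lie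
algebra, i.e. the set of all `v` with `exp(tv)` in the stabilizer for all `t`, is nonzero. -/
def HasPosDimStabilizer (S : Set M) : Prop :=
  ∃ v : Fin k → ℝ, v ≠ 0 ∧ ∀ t : ℝ, torusExp (t • v) ∈ fixingSubgroup (Torus k) S

/-- The value of the 1-form `φ' = i_{X_1} ⋯ i_{X_k} φ` on `w`, where `X_j` is the vector field of
the basis element `b j`; that is `φ(X_k, …, X_1, w)`. -/
def contraction (b : Module.Basis (Fin k) ℝ (Fin k → ℝ))
    (φ : (x : M) → TangentSpace 𝓘(ℂ, E) x [⋀^Fin (k + 1)]→L[ℂ] ℂ)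
    (x : M) (w : TangentSpace 𝓘(ℂ, E) x) : ℂ :=
  φ x (Fin.snoc (α := fun _ => TangentSpace 𝓘(ℂ, E) x)
    (fun j : Fin k => flowField (b j.rev) x) w)

/-- `f` is a holomorphic function on `M` with `df = φ'`. -/
def IsPotential (b : Module.Basis (Fin k) ℝ (Fin k → ℝ))
    (φ : (x : M) → TangentSpace 𝓘(ℂ, E) x [⋀^Fin (k + 1)]→L[ℂ] ℂ) (f : M → ℂ) : Prop :=
  MDifferentiable 𝓘(ℂ, E) 𝓘(ℂ, ℂ) f ∧
    ∀ (x : M) (w : TangentSpace 𝓘(ℂ, E) x), mfderiv 𝓘(ℂ, E) 𝓘(ℂ, ℂ) f x w = contraction b φ x w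

/-- The map `(μ, ξ) : M → ℝ^n`, `n = k + 1`: the coordinates of the moment map in the basis `b`,
followed by `ξ = Im f`. -/
def fibrationMap (b : Module.Basis (Fin k) ℝ (Fin k → ℝ)) (μ : M → Module.Dual ℝ (Fin k → ℝ))
    (f : M → ℂ) (x : M) : Fin (k + 1) → ℝ :=
  Fin.snoc (α := fun _ => ℝ) (fun j : Fin k => μ x (b j)) (f x).im

end Action

/-- A plane of codimension two in `ℝ^n`, i.e. an affine `(n - 2)`-plane. -/
def IsCodimTwoPlane {n : ℕ} (Q : AffineSubspace ℝ (Fin n → ℝ)) : Prop :=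
  (Q : Set (Fin n → ℝ)).Nonempty ∧ Module.finrank ℝ Q.direction + 2 = n

end CalabiYauTorus

end

/-! Write X_j for the fields of the basis and n = k + 1. One remark of linear algebra is used
throughout: on an n-dimensional space, an alternating bilinear form, or an alternating form of top
degree, is zero once inserting n - 1 independent vectors kills it (`bilin_eq_zero_of_radical`,
`alternating_eq_zero_of_contraction`).

Orbits are isotropic (`isotropic_flowField`): μ(v) changes at a constant rate along the flow of w,
and closed orbits force that rate to be zero. Positivity of κ then makes the X_j independent over ℂ
at regular points.

Potential: φ' is holomorphic, invariant and zero on every X_j, so Cartan's formula gives i_{X_j} dφ'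
= 0. Since dφ' is ℂ-bilinear, the remark yields dφ' = 0 at regular points. Any other point is a
limit of regular points or has a neighbourhood where φ' = 0, so φ' is closed
(`fderiv_realChartContraction_symm`). The vanishing of H¹ integrates its real and imaginary parts,
and the resulting function is holomorphic because its differential φ' is ℂ-linear.

Fibers: at a regular point the differential of (μ, ξ) is w ↦ (κ(X_j, w), Im φ'(w)). It is onto, and
its n-dimensional kernel contains the X_j. On this kernel each X_j is in the radical of κ, and Im φ
contracted with all X_j is Im φ' = 0; by the remark both forms vanish there
(`isSpecialLagrangian_fiber`).

Planes: along a stratum some X_v with v ≠ 0 vanishes, and so does φ'. Hence μ(v) and ξ are constant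
on it, two independent affine equations for its image (`exists_isCodimTwoPlane`). A fiber off these
planes has only regular points. -/

namespace CalabiYauTorus

/-! ### Linear algebra in one tangent space. -/

section LinearAlgebra

section Field

variable {K V : Type*} [Field K] [AddCommGroup V] [Module K V] {k : ℕ} {X : Fin k → V}

theorem exists_notMem_span_range (hV : Module.finrank K V = k + 1) :
    ∃ Y : V, Y ∉ Submodule.span K (Set.range X) := by
  by_contra! h
  have h1 : Submodule.span K (Set.range X) = ⊤ := Submodule.eq_top_iff'.2 h
  have h2 := finrank_range_le_card (R := K) X
  rw [Set.finrank, h1, finrank_top, hV, Fintype.card_fin] at h2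
  omega

/-- A linearly independent family of `k + 1` vectors in dimension `k + 1`, as a basis. -/
noncomputable def snocBasis (hV : Module.finrank K V = k + 1) (hX : LinearIndependent K X) {Y : V}
    (hY : Y ∉ Submodule.span K (Set.range X)) : Module.Basis (Fin (k + 1)) K V :=
  basisOfLinearIndependentOfCardEqFinrank (linearIndependent_finSnoc.2 ⟨hX, hY⟩) (by simp [hV])

theorem coe_snocBasis (hV : Module.finrank K V = k + 1) (hX : LinearIndependent K X) {Y : V}
    (hY : Y ∉ Submodule.span K (Set.range X)) :
    ⇑(snocBasis hV hX hY) = Fin.snoc (α := fun _ => V) X Y :=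
  coe_basisOfLinearIndependentOfCardEqFinrank _ _

/-- An alternating bilinear form on a space of dimension `k + 1` whose radical contains `k`
independent vectors vanishes. -/
theorem bilin_eq_zero_of_radical (hV : Module.finrank K V = k + 1) (hX : LinearIndependent K X)
    (B : V →ₗ[K] V →ₗ[K] K) (hB : ∀ u, B u u = 0) (hBX : ∀ j w, B (X j) w = 0) (u w : V) :
    B u w = 0 := by
  have hspan : ∀ u ∈ Submodule.span K (Set.range X), B u = 0 := by
    intro u hu
    have : Submodule.span K (Set.range X) ≤ LinearMap.ker B := by
      rw [Submodule.span_le]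
      rintro _ ⟨j, rfl⟩
      exact LinearMap.ext (hBX j)
    exact this hu
  have hskew : ∀ u w, B u w = - B w u := by
    intro u w
    have := hB (u + w)
    simp only [map_add, LinearMap.add_apply, hB, zero_add, add_zero] at this
    exact eq_neg_of_add_eq_zero_right this
  by_cases hu : u ∈ Submodule.span K (Set.range X)
  · simp [hspan u hu]
  -- Since `u` completes `X` to a basis, `w` is a multiple of `u` plus a vector of the radical.
  · have hw : w ∈ Submodule.span K (Set.range (snocBasis hV hX hu)) := by
      rw [Module.Basis.span_eq]; trivial
    rw [coe_snocBasis, Fin.range_snoc, Submodule.mem_span_insert] at hw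
    obtain ⟨a, z, hz, rfl⟩ := hw
    rw [map_add, map_smul, hB, hskew u z, hspan z hz]
    simp

/-- An alternating form of top degree vanishes if its contraction with independent vectors does. -/
theorem alternating_eq_zero_of_contraction (hV : Module.finrank K V = k + 1)
    (hX : LinearIndependent K X) (f : V [⋀^Fin (k + 1)]→ₗ[K] K)
    (hf : ∀ Y, f (Fin.snoc (α := fun _ => V) X Y) = 0) : f = 0 := by
  obtain ⟨Y, hY⟩ := exists_notMem_span_range (X := X) hV
  rw [← f.map_basis_eq_zero_iff (snocBasis hV hX hY), coe_snocBasis]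
  exact hf Y

end Field

section Regular

variable {E : Type*} [NormedAddCommGroup E] [NormedSpace ℂ E] {k : ℕ} {X : Fin k → E}
  {κ : E [⋀^Fin 2]→L[ℝ] ℝ}

/-- A real 2-form as a bilinear map. -/
noncomputable def formBilin (κ : E [⋀^Fin 2]→L[ℝ] ℝ) : E →ₗ[ℝ] E →ₗ[ℝ] ℝ :=
  LinearMap.mk₂ ℝ (fun u w => κ ![u, w])
    (fun u u' w => by simpa using κ.map_vecCons_add ![w] u u')
    (fun c u w => by simpa using κ.map_vecCons_smul ![w] c u)
    (fun u w w' => by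
      have h : ∀ z, ![u, z] = Function.update ![u, w] 1 z := fun z => by
        ext i; fin_cases i <;> rfl
      rw [h (w + w'), h w', κ.map_update_add, ← h, ← h])
    (fun c u w => by
      have h : ∀ z, ![u, z] = Function.update ![u, w] 1 z := fun z => by
        ext i; fin_cases i <;> rfl
      rw [h (c • w), κ.map_update_smul, ← h])

@[simp] theorem formBilin_apply (u w : E) : formBilin κ u w = κ ![u, w] := rfl

theorem formBilin_self (u : E) : formBilin κ u u = 0 :=
  κ.map_eq_zero_of_eq ![u, u] (i := 0) (j := 1) rfl (by decide)

/-- An isotropic family which is independent over `ℝ` is independent over `ℂ`. -/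
theorem linearIndependent_complex_of_isotropic (hpos : ∀ w : E, w ≠ 0 → 0 < κ ![w, Complex.I • w])
    (hX : LinearIndependent ℝ X) (hiso : ∀ i j, κ ![X i, X j] = 0) :
    LinearIndependent ℂ X := by
  rw [Fintype.linearIndependent_iff] at hX ⊢
  intro g hg
  have hiso' : ∀ a b : Fin k → ℝ, formBilin κ (∑ i, a i • X i) (∑ i, b i • X i) = 0 := by
    intro a b
    simp only [map_sum, LinearMap.sum_apply, map_smul, LinearMap.smul_apply, formBilin_apply, hiso,
      smul_zero, Finset.sum_const_zero]
  -- A complex relation reads A + iB = 0 with A, B in the real span. Then κ(B, iB) = -κ(B, A) = 0 by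
  -- isotropy, and positivity gives B = 0.
  have hsplit : (∑ i, (g i).re • X i) + Complex.I • (∑ i, (g i).im • X i) = 0 := by
    rw [← hg, Finset.smul_sum, ← Finset.sum_add_distrib]
    refine Finset.sum_congr rfl fun i _ => ?_
    rw [← Complex.coe_smul, ← Complex.coe_smul, smul_smul, ← add_smul, mul_comm, Complex.re_add_im]
  have him : (∑ i, (g i).im • X i) = 0 := by
    by_contra hne
    have h1 := hpos _ hne
    rw [eq_neg_of_add_eq_zero_right hsplit, ← formBilin_apply, map_neg, hiso'] at h1
    simp at h1
  have hre : (∑ i, (g i).re • X i) = 0 := by simpa [him] using hsplit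
  intro i
  exact Complex.ext (hX _ hre i) (hX _ him i)

variable {φ : E [⋀^Fin (k + 1)]→L[ℂ] ℂ}

/-- The contraction of a complex form of top degree with `k` vectors. -/
noncomputable def contractCLM (φ : E [⋀^Fin (k + 1)]→L[ℂ] ℂ) (X : Fin k → E) : E →L[ℂ] ℂ :=
  φ.toContinuousLinearMap (Fin.snoc (α := fun _ => E) X 0) (Fin.last k)

theorem contractCLM_apply (w : E) :
    contractCLM φ X w = φ (Fin.snoc (α := fun _ => E) X w) := by
  change φ (Function.update _ _ _) = _
  rw [Fin.update_snoc_last]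

theorem contractCLM_self (j : Fin k) : contractCLM φ X (X j) = 0 := by
  rw [contractCLM_apply]
  exact φ.map_eq_zero_of_eq _ (i := j.castSucc) (j := Fin.last k) (by simp)
    (Fin.castSucc_lt_last j).ne

theorem contractCLM_eq_zero_of_mem_span {w : E} (hw : w ∈ Submodule.span ℂ (Set.range X)) :
    contractCLM φ X w = 0 := by
  have : Submodule.span ℂ (Set.range X) ≤ LinearMap.ker (contractCLM φ X : E →ₗ[ℂ] ℂ) := by
    rw [Submodule.span_le]
    rintro _ ⟨j, rfl⟩
    exact contractCLM_self j
  exact this hw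

theorem contractCLM_eq_zero (hX : ¬ LinearIndependent ℂ X) : contractCLM φ X = 0 := by
  ext w
  rw [contractCLM_apply]
  exact φ.toAlternatingMap.map_linearDependent _ fun h => hX (linearIndependent_finSnoc.1 h).1

/-- The differential of the fibration at a regular point. -/
noncomputable def fibrationCLM (κ : E [⋀^Fin 2]→L[ℝ] ℝ) (φ : E [⋀^Fin (k + 1)]→L[ℂ] ℂ)
    (X Z : Fin k → E) : E →ₗ[ℝ] (Fin (k + 1) → ℝ) :=
  LinearMap.pi (Fin.snoc (α := fun _ => E →ₗ[ℝ] ℝ) (fun j => formBilin κ (X j))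
    (Complex.imLm ∘ₗ (contractCLM φ Z : E →ₗ[ℂ] ℂ).restrictScalars ℝ))

theorem fibrationCLM_apply_castSucc (Z : Fin k → E) (w : E) (j : Fin k) :
    fibrationCLM κ φ X Z w j.castSucc = κ ![X j, w] := by
  simp [fibrationCLM]

theorem fibrationCLM_apply_last (Z : Fin k → E) (w : E) :
    fibrationCLM κ φ X Z w (Fin.last k) = (contractCLM φ Z w).im := by
  simp [fibrationCLM]

variable (hE : Module.finrank ℂ E = k + 1)
  (hpos : ∀ w : E, w ≠ 0 → 0 < κ ![w, Complex.I • w])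
  (hX : LinearIndependent ℝ X) (hiso : ∀ i j, κ ![X i, X j] = 0) (hφ : φ ≠ 0) (σ : Fin k ≃ Fin k)

include hE hpos hX hiso hφ in
-- It suffices to restrict to the span of the i X_j and of a vector Y with φ'(Y) = i. There the
-- matrix is block triangular: φ' kills the i X_j, and κ(X_j, i X_l) is definite. The permutation
-- `σ` absorbs the reversed order of the fields in φ'.
theorem fibrationCLM_surjective :
    Function.Surjective (fibrationCLM κ φ X (X ∘ σ)) := by
  have hXσ : LinearIndependent ℂ (X ∘ σ) :=
    (linearIndependent_complex_of_isotropic hpos hX hiso).comp σ σ.injective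
  obtain ⟨Y, hY⟩ : ∃ Y, contractCLM φ (X ∘ σ) Y = Complex.I := by
    obtain ⟨Y, hY⟩ : ∃ Y, contractCLM φ (X ∘ σ) Y ≠ 0 := by
      by_contra! h
      refine hφ (ContinuousAlternatingMap.toAlternatingMap_injective ?_)
      exact alternating_eq_zero_of_contraction hE hXσ φ.toAlternatingMap fun Y =>
        contractCLM_apply (φ := φ) (X := X ∘ σ) Y ▸ h Y
    refine ⟨(Complex.I / contractCLM φ (X ∘ σ) Y) • Y, ?_⟩
    rw [map_smul, smul_eq_mul, div_mul_cancel₀ _ hY]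
  let g : (Fin k → ℝ) × ℝ →ₗ[ℝ] E :=
    LinearMap.coprod ((LinearMap.lsmul ℂ E Complex.I).restrictScalars ℝ ∘ₗ
      Fintype.linearCombination ℝ X) (LinearMap.toSpanSingleton ℝ E Y)
  have hg : ∀ c s, g (c, s) = Complex.I • (∑ i, c i • X i) + s • Y := fun c s => by
    simp [g, Fintype.linearCombination_apply, Finset.smul_sum, smul_comm Complex.I]
  have hspan : ∀ c : Fin k → ℝ, contractCLM φ (X ∘ σ) (∑ i, c i • X i) = 0 := by
    intro c
    refine contractCLM_eq_zero_of_mem_span (Submodule.sum_mem _ fun i _ => ?_)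
    rw [← Complex.coe_smul]
    exact Submodule.smul_mem _ _ (Submodule.subset_span ⟨σ.symm i, by simp⟩)
  have hinj : Function.Injective (fibrationCLM κ φ X (X ∘ σ) ∘ₗ g) := by
    rw [← LinearMap.ker_eq_bot, LinearMap.ker_eq_bot']
    rintro ⟨c, s⟩ hcs
    rw [LinearMap.comp_apply, hg] at hcs
    have hs : s = 0 := by
      have := congrFun hcs (Fin.last k)
      rw [fibrationCLM_apply_last, map_add, map_smul, hspan, ← Complex.coe_smul, map_smul, hY] at this
      simpa using this
    subst hs
    have hc : ∑ i, c i • X i = 0 := by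
      by_contra hne
      have h1 := hpos _ hne
      have h2 : ∀ j, formBilin κ (X j) (Complex.I • ∑ i, c i • X i) = 0 := fun j => by
        have := congrFun hcs j.castSucc
        rw [fibrationCLM_apply_castSucc] at this
        simpa using this
      rw [← formBilin_apply] at h1
      nth_rewrite 1 [map_sum] at h1
      simp only [map_smul, LinearMap.sum_apply, LinearMap.smul_apply, h2] at h1
      simp at h1
    have := Fintype.linearIndependent_iff.1 hX c hc
    exact Prod.ext (funext this) rfl
  have hsurj : Function.Surjective (fibrationCLM κ φ X (X ∘ σ) ∘ₗ g) :=
    (LinearMap.injective_iff_surjective_of_finrank_eq_finrank (by simp)).1 hinj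
  rw [LinearMap.coe_comp] at hsurj
  exact hsurj.of_comp

variable [FiniteDimensional ℂ E]

include hE hpos hX hiso hφ in
theorem finrank_ker_fibrationCLM :
    Module.finrank ℝ (LinearMap.ker (fibrationCLM κ φ X (X ∘ σ))) = k + 1 := by
  have : FiniteDimensional ℝ E := FiniteDimensional.complexToReal E
  have h := (fibrationCLM κ φ X (X ∘ σ)).finrank_range_add_finrank_ker
  rw [LinearMap.range_eq_top.2 (fibrationCLM_surjective hE hpos hX hiso hφ σ), finrank_top,
    finrank_real_of_complex, hE] at h
  simp only [Module.finrank_fintype_fun_eq_card, Fintype.card_fin] at h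
  omega

omit [FiniteDimensional ℂ E] in
include hiso in
theorem mem_ker_fibrationCLM (j : Fin k) : X j ∈ LinearMap.ker (fibrationCLM κ φ X (X ∘ σ)) := by
  rw [LinearMap.mem_ker]
  ext i
  cases i using Fin.lastCases with
  | last =>
    rw [fibrationCLM_apply_last,
      contractCLM_eq_zero_of_mem_span (Submodule.subset_span ⟨σ.symm j, by simp⟩)]
    rfl
  | cast i => rw [fibrationCLM_apply_castSucc, hiso]; rfl

omit [FiniteDimensional ℂ E] in
include hX hiso in
theorem linearIndependent_ker_fibrationCLM :
    LinearIndependent ℝ (fun j => (⟨X j, mem_ker_fibrationCLM hiso σ j⟩ :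
      LinearMap.ker (fibrationCLM κ φ X (X ∘ σ)))) :=
  LinearIndependent.of_comp (LinearMap.ker (fibrationCLM κ φ X (X ∘ σ))).subtype hX

include hE hpos hX hiso hφ in
-- The kernel has real dimension k + 1, and the k vectors X_j lie in it and in the radical of κ
-- restricted to it, by the first k equations of the kernel.
theorem lagrangian_ker_fibrationCLM {u w : E} (hu : fibrationCLM κ φ X (X ∘ σ) u = 0)
    (hw : fibrationCLM κ φ X (X ∘ σ) w = 0) : κ ![u, w] = 0 := by
  let W := LinearMap.ker (fibrationCLM κ φ X (X ∘ σ))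
  refine bilin_eq_zero_of_radical (finrank_ker_fibrationCLM hE hpos hX hiso hφ σ)
    (linearIndependent_ker_fibrationCLM hX hiso σ)
    ((formBilin κ).domRestrict₁₂ W W) (fun u => formBilin_self (κ := κ) (u : E)) ?_
    ⟨u, hu⟩ ⟨w, hw⟩
  rintro j ⟨w, hw⟩
  have := congrFun (LinearMap.mem_ker.1 hw) j.castSucc
  rwa [fibrationCLM_apply_castSucc] at this

include hE hpos hX hiso hφ in
-- On the kernel Im φ is a real form of top degree, and the last equation of the kernel says that
-- its contraction with the X_j is zero.
theorem special_ker_fibrationCLM {u : Fin (k + 1) → E}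
    (hu : ∀ i, fibrationCLM κ φ X (X ∘ σ) (u i) = 0) : (φ u).im = 0 := by
  let W := LinearMap.ker (fibrationCLM κ φ X (X ∘ σ))
  let f : W [⋀^Fin (k + 1)]→ₗ[ℝ] ℝ :=
    (Complex.imLm.compAlternatingMap (φ.restrictScalars ℝ).toAlternatingMap).compLinearMap W.subtype
  have hf : f = 0 := by
    refine alternating_eq_zero_of_contraction (finrank_ker_fibrationCLM hE hpos hX hiso hφ σ)
      ((linearIndependent_ker_fibrationCLM hX hiso σ).comp σ σ.injective) f ?_
    rintro ⟨Y, hY⟩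
    have h1 := congrFun (LinearMap.mem_ker.1 hY) (Fin.last k)
    rw [fibrationCLM_apply_last, contractCLM_apply] at h1
    have h2 : (fun i => W.subtype (Fin.snoc (α := fun _ => W)
        ((fun j => (⟨X j, mem_ker_fibrationCLM hiso σ j⟩ : W)) ∘ σ) ⟨Y, hY⟩ i)) =
        Fin.snoc (α := fun _ => E) (X ∘ σ) Y := by
      ext i
      cases i using Fin.lastCases <;> simp
    change (φ _).im = 0
    rw [h2]
    exact h1
  exact DFunLike.congr_fun hf fun i => (⟨u i, hu i⟩ : W)

end Regular

end LinearAlgebra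

end CalabiYauTorus

namespace CalabiYauTorus

/-! ### Local flows in a vector space. -/

section Flow

variable {E : Type*} [NormedAddCommGroup E] [NormedSpace ℂ E] {Φ : ℝ × E → E} {y₀ : E}

/-- The vector field generating a local flow. -/
noncomputable def generator (Φ : ℝ × E → E) (y : E) : E := fderiv ℝ Φ (0, y) (1, 0)

/-- The mixed second derivative of a local flow. -/
noncomputable def mixedDeriv (Φ : ℝ × E → E) (y : E) : E →L[ℝ] E :=
  (fderiv ℝ (fderiv ℝ Φ) (0, y) (1, 0)).comp (.inr ℝ ℝ E)

theorem differentiableAt_fderiv_of_contDiffAt_two (hΦ : ContDiffAt ℝ 2 Φ (0, y₀)) :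
    DifferentiableAt ℝ (fderiv ℝ Φ) (0, y₀) :=
  (hΦ.fderiv_right (m := 1) (by norm_num)).differentiableAt one_ne_zero

/-- Symmetry of second derivatives: differentiating in time and then in space gives the same as the
reverse order, which is the one computed in `hasDerivAt_fderiv_flow`. -/
theorem hasFDerivAt_generator (hΦ : ContDiffAt ℝ 2 Φ (0, y₀)) :
    HasFDerivAt (generator Φ) (mixedDeriv Φ y₀) y₀ := by
  have h1 : HasFDerivAt (fun y : E => ((0 : ℝ), y)) (.inr ℝ ℝ E) y₀ := hasFDerivAt_prodMk_right 0 y₀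
  have h2 := (differentiableAt_fderiv_of_contDiffAt_two hΦ).hasFDerivAt.comp y₀ h1
  have h3 := h2.clm_apply (hasFDerivAt_const ((1 : ℝ), (0 : E)) y₀)
  refine h3.congr_fderiv ?_
  ext w
  have hs := (hΦ.isSymmSndFDerivAt (by simp)) (0, w) (1, 0)
  simpa [mixedDeriv] using hs

theorem hasDerivAt_fderiv_flow (hΦ : ContDiffAt ℝ 2 Φ (0, y₀)) :
    HasDerivAt (fun t : ℝ => fderiv ℝ (fun y => Φ (t, y)) y₀) (mixedDeriv Φ y₀) 0 := by
  have h1 : HasDerivAt (fun t : ℝ => (t, y₀)) ((1 : ℝ), (0 : E)) 0 :=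
    (hasDerivAt_id (0 : ℝ)).prodMk (hasDerivAt_const (0 : ℝ) y₀)
  have h2 := HasFDerivAt.comp_hasDerivAt (0 : ℝ)
    (differentiableAt_fderiv_of_contDiffAt_two hΦ).hasFDerivAt h1
  have h3 : HasDerivAt (fun t : ℝ => (fderiv ℝ Φ (t, y₀)).comp (.inr ℝ ℝ E))
      (mixedDeriv Φ y₀) 0 := by
    have := h2.clm_comp (hasDerivAt_const (0 : ℝ) (ContinuousLinearMap.inr ℝ ℝ E))
    simpa [mixedDeriv] using this
  refine h3.congr_of_eventuallyEq ?_
  have h4 : ∀ᶠ p in 𝓝 ((0 : ℝ), y₀), DifferentiableAt ℝ Φ p :=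
    (hΦ.eventually (by simp)).mono fun p hp => hp.differentiableAt (by simp)
  have h5 : Filter.Tendsto (fun t : ℝ => (t, y₀)) (𝓝 0) (𝓝 (0, y₀)) := h1.continuousAt
  filter_upwards [h5.eventually h4] with t ht
  exact (ht.hasFDerivAt.comp y₀ (hasFDerivAt_prodMk_right t y₀)).fderiv

/-- The generator of a holomorphic flow is holomorphic. -/
theorem differentiableAt_generator (hΦ : ContDiffAt ℝ 2 Φ (0, y₀))
    (hol : ∀ᶠ t : ℝ in 𝓝 0, DifferentiableAt ℂ (fun y => Φ (t, y)) y₀) :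
    DifferentiableAt ℂ (generator Φ) y₀ := by
  -- The mixed derivative is a time derivative of ℂ-linear maps, so it commutes with i.
  have hI : ∀ w, mixedDeriv Φ y₀ (Complex.I • w) = Complex.I • mixedDeriv Φ y₀ w := by
    intro w
    have h1 := (hasDerivAt_fderiv_flow hΦ).clm_apply
      (hasDerivAt_const (0 : ℝ) (Complex.I • w))
    have h2 := ((hasDerivAt_fderiv_flow hΦ).clm_apply
      (hasDerivAt_const (0 : ℝ) w)).const_smul Complex.I
    simp only [map_zero, add_zero] at h1 h2
    refine h1.unique (h2.congr_of_eventuallyEq ?_)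
    filter_upwards [hol] with t ht
    simp [ht.fderiv_restrictScalars ℝ]
  let L : E →L[ℂ] E :=
    { toFun := mixedDeriv Φ y₀
      map_add' := map_add _
      map_smul' := fun c w => by
        have : c • w = c.re • w + c.im • (Complex.I • w) := by
          rw [← Complex.coe_smul, ← Complex.coe_smul, smul_smul, ← add_smul, Complex.re_add_im]
        simp only [this, map_add, map_smul, hI, RingHom.id_apply]
        rw [← Complex.coe_smul, ← Complex.coe_smul, smul_smul, ← add_smul, Complex.re_add_im]
      cont := (mixedDeriv Φ y₀).cont }
  exact (hasFDerivAt_of_restrictScalars (f' := L) ℝ (hasFDerivAt_generator hΦ)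
    (by ext; rfl)).differentiableAt

/-- Cartan's formula for an invariant 1-form that vanishes on the generator of the flow. -/
theorem fderiv_symm_of_invariant {A : E → E →L[ℝ] ℂ} (hΦ : ContDiffAt ℝ 2 Φ (0, y₀))
    (h0 : ∀ᶠ y in 𝓝 y₀, Φ (0, y) = y) (hA : DifferentiableAt ℝ A y₀)
    (inv : ∀ᶠ t : ℝ in 𝓝 0, (A (Φ (t, y₀))).comp (fderiv ℝ (fun y => Φ (t, y)) y₀) = A y₀)
    (hker : ∀ᶠ y in 𝓝 y₀, A y (generator Φ y) = 0) (w : E) :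
    fderiv ℝ A y₀ (generator Φ y₀) w = fderiv ℝ A y₀ w (generator Φ y₀) := by
  have h1 : HasDerivAt (fun t : ℝ => Φ (t, y₀)) (generator Φ y₀) 0 :=
    (hΦ.differentiableAt (by simp)).hasFDerivAt.comp_hasDerivAt (0 : ℝ)
      ((hasDerivAt_id (0 : ℝ)).prodMk (hasDerivAt_const (0 : ℝ) y₀))
  have hid : fderiv ℝ (fun y => Φ (0, y)) y₀ = .id ℝ E := by
    rw [Filter.EventuallyEq.fderiv_eq (f₁ := fun y => Φ (0, y)) (f := id) h0, fderiv_id]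
  have hA' : HasFDerivAt A (fderiv ℝ A y₀) (Φ (0, y₀)) := by
    rw [h0.self_of_nhds]; exact hA.hasFDerivAt
  -- With X the generator, invariance gives DA(X)(w) + A(DX w) = 0, while differentiating A(X) = 0
  -- along w gives DA(w)(X) + A(DX w) = 0. The claim is the difference.
  have h2 : HasDerivAt (fun t : ℝ => A (Φ (t, y₀)) (fderiv ℝ (fun y => Φ (t, y)) y₀ w))
      (fderiv ℝ A y₀ (generator Φ y₀) w + A y₀ (mixedDeriv Φ y₀ w)) 0 := by
    have h3 := (hasDerivAt_fderiv_flow hΦ).clm_apply (hasDerivAt_const (0 : ℝ) w)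
    have h4 : HasDerivAt (fun t : ℝ => A (Φ (t, y₀))) (fderiv ℝ A y₀ (generator Φ y₀)) 0 :=
      hA'.comp_hasDerivAt (0 : ℝ) h1
    refine (h4.clm_apply h3).congr_deriv ?_
    simp only [hid, h0.self_of_nhds, map_zero, add_zero]
    rfl
  have h5 : HasDerivAt (fun t : ℝ => A (Φ (t, y₀)) (fderiv ℝ (fun y => Φ (t, y)) y₀ w)) 0 0 := by
    refine (hasDerivAt_const (0 : ℝ) (A y₀ w)).congr_of_eventuallyEq ?_
    filter_upwards [inv] with t ht
    exact DFunLike.congr_fun ht w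
  have h6 : HasFDerivAt (fun y => A y (generator Φ y)) (0 : E →L[ℝ] ℂ) y₀ :=
    (hasFDerivAt_const (0 : ℂ) y₀).congr_of_eventuallyEq hker
  have h7 := h6.unique (hA.hasFDerivAt.clm_apply (hasFDerivAt_generator hΦ))
  have h8 := DFunLike.congr_fun h7 w
  have h9 := h2.unique h5
  simp at h8
  linear_combination h9 + h8

end Flow

/-! ### Real and complex differentials; functions on connected submanifolds. -/

section Manifold

variable {E : Type*} [NormedAddCommGroup E] [NormedSpace ℂ E]
  {M : Type*} [TopologicalSpace M] [ChartedSpace E M]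

variable (E M) in
/-- A complex manifold is a smooth real manifold. -/
theorem isManifold_real [IsManifold 𝓘(ℂ, E) ω M] : IsManifold 𝓘(ℝ, E) ∞ M := by
  refine isManifold_of_contDiffOn _ _ _ fun e e' he he' => ?_
  have h := (contDiffGroupoid ω 𝓘(ℂ, E)).compatible he he'
  rw [contDiffGroupoid, mem_groupoid_of_pregroupoid] at h
  exact (h.1.restrict_scalars ℝ).of_le (by exact le_top)

theorem HasMFDerivAt.real {F : Type*} [NormedAddCommGroup F] [NormedSpace ℂ F]
    {N : Type*} [TopologicalSpace N] [ChartedSpace F N] {f : M → N} {x : M}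
    {f' : E →L[ℂ] F}
    (h : HasMFDerivAt 𝓘(ℂ, E) 𝓘(ℂ, F) f x f') :
    HasMFDerivAt 𝓘(ℝ, E) 𝓘(ℝ, F) f x
      (f'.restrictScalars ℝ : E →L[ℝ] F) :=
  ⟨h.1, HasFDerivWithinAt.restrictScalars ℝ h.2⟩

/-- Cauchy–Riemann: a real differential that happens to be ℂ-linear is a complex one. This makes the
primitive of φ' holomorphic. -/
theorem HasMFDerivAt.of_real {F : Type*} [NormedAddCommGroup F] [NormedSpace ℂ F]
    {N : Type*} [TopologicalSpace N] [ChartedSpace F N] {f : M → N} {x : M}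
    {f' : E →L[ℂ] F}
    (h : HasMFDerivAt 𝓘(ℝ, E) 𝓘(ℝ, F) f x
      (f'.restrictScalars ℝ : E →L[ℝ] F)) :
    HasMFDerivAt 𝓘(ℂ, E) 𝓘(ℂ, F) f x f' :=
  ⟨h.1, HasFDerivWithinAt.of_restrictScalars ℝ h.2 rfl⟩

theorem mfderiv_real_apply {F : Type*} [NormedAddCommGroup F] [NormedSpace ℂ F]
    {N : Type*} [TopologicalSpace N] [ChartedSpace F N] {f : M → N} {x : M}
    (h : MDifferentiableAt 𝓘(ℂ, E) 𝓘(ℂ, F) f x) (w : E) :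
    (mfderiv 𝓘(ℝ, E) 𝓘(ℝ, F) f x : E → F) w = (mfderiv 𝓘(ℂ, E) 𝓘(ℂ, F) f x : E → F) w := by
  rw [(HasMFDerivAt.real h.hasMFDerivAt).mfderiv]
  rfl

theorem MDifferentiableAt.real {F : Type*} [NormedAddCommGroup F] [NormedSpace ℂ F]
    {N : Type*} [TopologicalSpace N] [ChartedSpace F N] {f : M → N} {x : M}
    (h : MDifferentiableAt 𝓘(ℂ, E) 𝓘(ℂ, F) f x) : MDifferentiableAt 𝓘(ℝ, E) 𝓘(ℝ, F) f x :=
  (HasMFDerivAt.real h.hasMFDerivAt).mdifferentiableAt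

/-- A function whose differential vanishes along a connected submanifold is constant on it. -/
theorem eqOn_of_mfderiv_eq_zero [IsManifold 𝓘(ℝ, E) ∞ M] {F : Type*} [NormedAddCommGroup F]
    [NormedSpace ℝ F] {S : Set M} {d : ℕ} (hS : IsSubmanifold (E := E) d S)
    (hconn : IsPreconnected S) {g : M → F} (hg : MDifferentiable 𝓘(ℝ, E) 𝓘(ℝ, F) g)
    (h0 : ∀ x ∈ S, ∀ w : TangentSpace 𝓘(ℝ, E) x, mfderiv 𝓘(ℝ, E) 𝓘(ℝ, F) g x w = 0)
    {x y : M} (hx : x ∈ S) (hy : y ∈ S) : g x = g y := by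
  have : PreconnectedSpace S := isPreconnected_iff_preconnectedSpace.1 hconn
  have hloc : IsLocallyConstant (fun z : S => g z) := by
    rw [IsLocallyConstant.iff_eventually_eq]
    rintro ⟨x, hx⟩
    obtain ⟨e, he, hxe, V, -, hV⟩ := hS x hx
    obtain ⟨ε, hε, hball⟩ := Metric.isOpen_iff.1 e.open_target (e x) (e.map_source hxe)
    have hnear : ∀ᶠ y in 𝓝 x, y ∈ e.source ∧ e y ∈ Metric.ball (e x) ε :=
      (e.open_source.eventually_mem hxe).and
        ((e.continuousAt hxe).eventually (Metric.ball_mem_nhds _ hε))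
    filter_upwards [continuous_subtype_val.continuousAt.eventually hnear]
    rintro ⟨y, hy⟩ ⟨hye, hyb⟩
    -- In a flattening chart the segment from x to y stays in S, since V is a linear subspace, and
    -- in the ball, which is convex.
    let c : ℝ → E := fun s => e x + s • (e y - e x)
    have hc : ∀ s ∈ Set.Icc (0 : ℝ) 1, c s ∈ Metric.ball (e x) ε := by
      intro s hs
      have := (convex_ball (e x) ε).add_smul_sub_mem (Metric.mem_ball_self hε) hyb hs
      exact this
    have hct : ∀ s ∈ Set.Icc (0 : ℝ) 1, c s ∈ e.target := fun s hs => hball (hc s hs)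
    have hcS : ∀ s ∈ Set.Icc (0 : ℝ) 1, e.symm (c s) ∈ S := by
      intro s hs
      rw [hV _ (e.map_target (hct s hs)), e.right_inv (hct s hs)]
      simpa [c] using V.smul_mem s ((hV y hye).1 hy)
    have hder : ∀ s ∈ Set.Icc (0 : ℝ) 1, HasDerivAt (fun s => g (e.symm (c s))) 0 s := by
      intro s hs
      have h1 : HasDerivAt c (e y - e x) s := by
        exact (((hasDerivAt_id s).smul_const (e y - e x)).const_add (e x)).congr_deriv (one_smul _ _)
      have h2 : MDifferentiableAt 𝓘(ℝ, E) 𝓘(ℝ, E) e.symm (c s) :=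
        (contMDiffAt_symm_of_mem_maximalAtlas he (hct s hs)).mdifferentiableAt (by simp)
      have h3 : HasMFDerivAt 𝓘(ℝ, E) 𝓘(ℝ, F) (g ∘ e.symm) (c s) 0 := by
        refine ((hg _).hasMFDerivAt.comp _ h2.hasMFDerivAt).congr_mfderiv ?_
        ext w
        exact h0 _ (hcS s hs) _
      exact (hasMFDerivAt_iff_hasFDerivAt.1 h3).comp_hasDerivAt s h1
    have := constant_of_derivWithin_zero (f := fun s => g (e.symm (c s))) (a := 0) (b := 1)
      (fun s hs => (hder s hs).differentiableAt.differentiableWithinAt)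
      (fun s hs => (hder s ⟨hs.1, hs.2.le⟩).hasDerivWithinAt.derivWithin
        (uniqueDiffOn_Icc zero_lt_one s ⟨hs.1, hs.2.le⟩)) 1 (by simp)
    simpa [c, e.left_inv hxe, e.left_inv hye] using this
  exact hloc.apply_eq_of_preconnectedSpace ⟨x, hx⟩ ⟨y, hy⟩

end Manifold

end CalabiYauTorus

namespace CalabiYauTorus

/-! ### The regular value theorem. -/

section LevelSet

variable {E : Type*} [NormedAddCommGroup E] [NormedSpace ℂ E] [FiniteDimensional ℂ E]
  {M : Type*} [TopologicalSpace M] [ChartedSpace E M] [IsManifold 𝓘(ℝ, E) ∞ M]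

/-- A smooth map on an open set, with invertible differential at a point, is a diffeomorphism near
that point. -/
theorem exists_openPartialHomeomorph_of_contDiffOn {G : E → E} {U : Set E} (hU : IsOpen U)
    (hG : ContDiffOn ℝ ∞ G U) {y₀ : E} (hy₀ : y₀ ∈ U)
    (hG' : HasFDerivAt G (ContinuousLinearMap.id ℝ E) y₀) :
    ∃ R : OpenPartialHomeomorph E E, y₀ ∈ R.source ∧ R.source ⊆ U ∧ (⇑R = G) ∧
      ContDiffOn ℝ ∞ R.symm R.target := by
  have : FiniteDimensional ℝ E := FiniteDimensional.complexToReal E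
  have : CompleteSpace E := FiniteDimensional.complete ℝ E
  have hGa : ∀ y ∈ U, ContDiffAt ℝ ∞ G y := fun y hy => hG.contDiffAt (hU.mem_nhds hy)
  have hG1 : HasFDerivAt G ((ContinuousLinearEquiv.refl ℝ E : E ≃L[ℝ] E) : E →L[ℝ] E) y₀ := hG'
  let R₀ := (hGa y₀ hy₀).toOpenPartialHomeomorph G hG1 (by simp)
  -- Invertibility of the derivative is an open condition; imposing it at every point of the source
  -- makes the inverse smooth on the whole target, not just at one point.
  let U' := U ∩ fderiv ℝ G ⁻¹' Set.range ((↑) : (E ≃L[ℝ] E) → E →L[ℝ] E)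
  have hU' : IsOpen U' :=
    (hG.fderiv_of_isOpen (m := 0) hU (by simp)).continuousOn.isOpen_inter_preimage hU
      ContinuousLinearEquiv.isOpen
  refine ⟨R₀.restrOpen U' hU', ?_, fun y hy => hy.2.1, rfl, ?_⟩
  · exact ⟨(hGa y₀ hy₀).mem_toOpenPartialHomeomorph_source hG1 (by simp),
      hy₀, ContinuousLinearEquiv.refl ℝ E, hG1.fderiv.symm⟩
  · intro z hz
    have hz' := (R₀.restrOpen U' hU').map_target hz
    obtain ⟨-, hzU, L, hL⟩ := hz'
    refine (OpenPartialHomeomorph.contDiffAt_symm (f₀' := L) _ hz ?_ (hGa _ hzU)).contDiffWithinAt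
    rw [hL]
    exact ((hGa _ hzU).differentiableAt (by simp)).hasFDerivAt

/-- The regular value theorem. -/
theorem isSubmanifold_preimage {n d : ℕ} (hd : Module.finrank ℝ E = n + d)
    {F : M → Fin n → ℝ} (hF : ContMDiff 𝓘(ℝ, E) 𝓘(ℝ, Fin n → ℝ) ∞ F) {p : Fin n → ℝ}
    (hreg : ∀ x, F x = p →
      Function.Surjective (mfderiv 𝓘(ℝ, E) 𝓘(ℝ, Fin n → ℝ) F x : E → (Fin n → ℝ))) :
    IsSubmanifold (E := E) d (F ⁻¹' {p}) := by
  have : FiniteDimensional ℝ E := FiniteDimensional.complexToReal E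
  intro x hx
  let c := chartAt E x
  have hc : c ∈ IsManifold.maximalAtlas 𝓘(ℝ, E) ∞ M := IsManifold.chart_mem_maximalAtlas x
  have hxc : x ∈ c.source := mem_chart_source E x
  have hcx : c x ∈ c.target := c.map_source hxc
  let G₀ : E → Fin n → ℝ := F ∘ c.symm
  have hG₀ : ContDiffOn ℝ ∞ G₀ c.target :=
    (hF.comp_contMDiffOn (contMDiffOn_symm_of_mem_maximalAtlas hc)).contDiffOn
  have hG₀d : DifferentiableAt ℝ G₀ (c x) :=
    (hG₀.contDiffAt (c.open_target.mem_nhds hcx)).differentiableAt (by simp)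
  let A := fderiv ℝ G₀ (c x)
  have hA : Function.Surjective A := by
    have h1 : MDifferentiableAt 𝓘(ℝ, E) 𝓘(ℝ, E) c.symm (c x) :=
      (contMDiffAt_symm_of_mem_maximalAtlas hc hcx).mdifferentiableAt (by simp)
    have h2 : MDifferentiableAt 𝓘(ℝ, E) 𝓘(ℝ, Fin n → ℝ) F (c.symm (c x)) :=
      (hF _).mdifferentiableAt (by simp)
    have h3 : A = (mfderiv 𝓘(ℝ, E) 𝓘(ℝ, Fin n → ℝ) F (c.symm (c x))).comp
        (mfderiv 𝓘(ℝ, E) 𝓘(ℝ, E) c.symm (c x)) := by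
      rw [← mfderiv_comp _ h2 h1, mfderiv_eq_fderiv]
    have h4 : Function.Surjective
        (mfderiv 𝓘(ℝ, E) 𝓘(ℝ, Fin n → ℝ) F (c.symm (c x)) : E → Fin n → ℝ) :=
      hreg _ (by rw [c.left_inv hxc]; exact hx)
    have h5 : Function.Surjective (mfderiv 𝓘(ℝ, E) 𝓘(ℝ, E) c.symm (c x) : E → E) := by
      have : IsManifold 𝓘(ℝ, E) 1 M := IsManifold.of_le (n := ∞) (by simp)
      exact (mdifferentiable_chart (I := 𝓘(ℝ, E)) x).symm.mfderiv_surjective hcx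
    rw [h3]
    intro z
    obtain ⟨u, rfl⟩ := h4 z
    obtain ⟨w, rfl⟩ := h5 u
    exact ⟨w, rfl⟩
  obtain ⟨s, hs⟩ : ∃ s : (Fin n → ℝ) →L[ℝ] E, A.comp s = .id ℝ _ := by
    obtain ⟨s, hs⟩ := LinearMap.exists_rightInverse_of_surjective (A : E →ₗ[ℝ] Fin n → ℝ)
      (LinearMap.range_eq_top.2 hA)
    exact ⟨s.toContinuousLinearMap, ContinuousLinearMap.coe_injective hs⟩
  have hs' : ∀ z, A (s z) = z := fun z => DFunLike.congr_fun hs z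
  -- The derivative of `G` at the base point is the identity, because `A` is that of `G₀`; and A ∘ G
  -- = G₀, because `s` is a right inverse of `A`. So `G` straightens the level set to a translate of
  -- ker A.
  let G : E → E := fun y => y + s (G₀ y - A y)
  have hG : ContDiffOn ℝ ∞ G c.target :=
    contDiffOn_id.add (s.contDiff.comp_contDiffOn (hG₀.sub A.contDiff.contDiffOn))
  have hG' : HasFDerivAt G (ContinuousLinearMap.id ℝ E) (c x) := by
    refine ((hasFDerivAt_id (c x)).add
      (s.hasFDerivAt.comp (c x) (hG₀d.hasFDerivAt.sub A.hasFDerivAt))).congr_fderiv ?_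
    simp [A]
  obtain ⟨R, hxR, hRc, hRG, hRs⟩ :=
    exists_openPartialHomeomorph_of_contDiffOn c.open_target hG hcx hG'
  refine ⟨c.trans R, ?_, ?_, LinearMap.ker (A : E →ₗ[ℝ] Fin n → ℝ), ?_, ?_⟩
  · refine OpenPartialHomeomorph.mem_maximalAtlas_of_contMDiffOn _ ?_ ?_
    · rw [OpenPartialHomeomorph.coe_trans, hRG]
      exact hG.contMDiffOn.comp ((contMDiffOn_of_mem_maximalAtlas hc).mono (by simp))
        fun y hy => hRc hy.2
    · exact (contMDiffOn_symm_of_mem_maximalAtlas hc).comp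
        (hRs.contMDiffOn.mono (by simp)) fun y hy => hy.2
  · exact ⟨hxc, hxR⟩
  · have h := (A : E →ₗ[ℝ] Fin n → ℝ).finrank_range_add_finrank_ker
    rw [LinearMap.range_eq_top.2 hA, finrank_top, hd] at h
    simpa using h
  · intro y hy
    have hyc : y ∈ c.source := hy.1
    have key : A ((c.trans R) y - (c.trans R) x) = F y - F x := by
      simp only [OpenPartialHomeomorph.coe_trans, Function.comp_apply, hRG, G, map_sub, map_add, hs',
        G₀, c.left_inv hyc, c.left_inv hxc]
      abel
    change F y = p ↔ A _ = 0
    rw [key, sub_eq_zero, show F x = p from hx]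

end LevelSet

/-! ### The torus action: induced fields and isotropy of the orbits. -/

section Action

theorem torusExp_add {k : ℕ} (v w : Fin k → ℝ) : torusExp (v + w) = torusExp v * torusExp w :=
  funext fun _ => Circle.exp_add _ _

theorem torusExp_zero {k : ℕ} : torusExp (0 : Fin k → ℝ) = 1 :=
  funext fun _ => Circle.exp_zero

theorem torusExp_two_pi_smul_single {k : ℕ} (j : Fin k) :
    torusExp ((2 * Real.pi) • (Pi.single j 1 : Fin k → ℝ)) = 1 := by
  funext i
  by_cases h : i = j
  · subst h; simp [torusExp, Circle.exp_two_pi]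
  · simp [torusExp, h]

variable {k : ℕ} {E : Type*} [NormedAddCommGroup E] [NormedSpace ℂ E]
  {M : Type*} [TopologicalSpace M] [ChartedSpace E M] [MulAction (Torus k) M]

theorem contMDiff_orbit (hsmooth : IsSmoothAction k E M) (x : M) :
    ContMDiff 𝓘(ℝ, Fin k → ℝ) 𝓘(ℝ, E) ∞ (fun v : Fin k → ℝ => torusExp v • x) :=
  hsmooth.comp (contMDiff_id.prodMk contMDiff_const)

/-- The one-parameter group law reduces time `s` to time 0 at the moved point. -/
theorem hasMFDerivAt_flow (hsmooth : IsSmoothAction k E M) (v : Fin k → ℝ) (x : M) (s : ℝ) :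
    HasMFDerivAt 𝓘(ℝ, ℝ) 𝓘(ℝ, E) (fun t : ℝ => torusExp (t • v) • x) s
      (ContinuousLinearMap.toSpanSingleton ℝ
        (flowField (E := E) v (torusExp (s • v) • x) : E)) := by
  have hsm : ∀ x : M, ContMDiff 𝓘(ℝ, ℝ) 𝓘(ℝ, E) ∞ (fun t : ℝ => torusExp (t • v) • x) := fun x =>
    (contMDiff_orbit hsmooth x).comp
      (contDiff_id.smul contDiff_const : ContDiff ℝ ∞ fun t : ℝ => t • v).contMDiff
  let y : M := torusExp (s • v) • x
  -- The base point is written `s - s` to match the composition with t ↦ t - s.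
  have h0 : HasMFDerivAt 𝓘(ℝ, ℝ) 𝓘(ℝ, E) (fun t : ℝ => torusExp (t • v) • y) (s - s)
      (ContinuousLinearMap.toSpanSingleton ℝ (flowField (E := E) v y : E)) := by
    rw [sub_self]
    refine ((hsm y 0).mdifferentiableAt (by simp)).hasMFDerivAt.congr_mfderiv ?_
    ext
    change _ = (1 : ℝ) • (flowField (E := E) v y : E)
    rw [one_smul]
    rfl
  have h1 : HasMFDerivAt 𝓘(ℝ, ℝ) 𝓘(ℝ, ℝ) (fun t : ℝ => t - s) s (.id ℝ ℝ) :=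
    ((hasFDerivAt_id s).sub_const s).hasMFDerivAt
  have h2 := HasMFDerivAt.comp (f := fun t : ℝ => t - s) s h0 h1
  have h3 : (fun t : ℝ => torusExp (t • v) • y) ∘ (fun t : ℝ => t - s) =
      fun t : ℝ => torusExp (t • v) • x := by
    funext t
    simp only [Function.comp_apply, y]
    rw [smul_smul, ← torusExp_add, ← add_smul, sub_add_cancel]
  rw [h3] at h2
  exact h2

theorem flowField_eq_mfderiv_orbit (hsmooth : IsSmoothAction k E M) (v : Fin k → ℝ) (x : M) :
    (flowField v x : E) =
      (mfderiv 𝓘(ℝ, Fin k → ℝ) 𝓘(ℝ, E) (fun v : Fin k → ℝ => torusExp v • x) 0 :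
        (Fin k → ℝ) → E) v := by
  have h0 : HasMFDerivAt 𝓘(ℝ, Fin k → ℝ) 𝓘(ℝ, E) (fun v : Fin k → ℝ => torusExp v • x)
      ((0 : ℝ) • v) (mfderiv 𝓘(ℝ, Fin k → ℝ) 𝓘(ℝ, E) (fun v : Fin k → ℝ => torusExp v • x) 0 :
        (Fin k → ℝ) →L[ℝ] E) := by
    rw [zero_smul]
    exact ((contMDiff_orbit hsmooth x 0).mdifferentiableAt (by simp)).hasMFDerivAt
  have h1 : HasMFDerivAt 𝓘(ℝ, ℝ) 𝓘(ℝ, Fin k → ℝ) (fun t : ℝ => t • v) 0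
      (ContinuousLinearMap.toSpanSingleton ℝ v) :=
    (ContinuousLinearMap.toSpanSingleton ℝ v).hasMFDerivAt
  have h2 := (HasMFDerivAt.comp (f := fun t : ℝ => t • v) 0 h0 h1).mfderiv
  change (mfderiv 𝓘(ℝ, ℝ) 𝓘(ℝ, E) ((fun v : Fin k → ℝ => torusExp v • x) ∘ fun t : ℝ => t • v) 0 :
    ℝ → E) 1 = _
  rw [h2]
  change (mfderiv 𝓘(ℝ, Fin k → ℝ) 𝓘(ℝ, E) (fun v : Fin k → ℝ => torusExp v • x) 0 :
        (Fin k → ℝ) → E) ((1 : ℝ) • v) = _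
  rw [one_smul]

/-- The infinitesimal action at a point, as a linear map. -/
noncomputable def infinitesimalAction (hsmooth : IsSmoothAction k E M) (x : M) : (Fin k → ℝ) →ₗ[ℝ] E where
  toFun v := flowField v x
  map_add' v w := by
    simp only [flowField_eq_mfderiv_orbit hsmooth]
    exact (mfderiv 𝓘(ℝ, Fin k → ℝ) 𝓘(ℝ, E) (fun v : Fin k → ℝ => torusExp v • x) 0 :
      (Fin k → ℝ) →L[ℝ] E).map_add v w
  map_smul' c v := by
    simp only [flowField_eq_mfderiv_orbit hsmooth]
    exact (mfderiv 𝓘(ℝ, Fin k → ℝ) 𝓘(ℝ, E) (fun v : Fin k → ℝ => torusExp v • x) 0 :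
      (Fin k → ℝ) →L[ℝ] E).map_smul c v

theorem infinitesimalAction_apply (hsmooth : IsSmoothAction k E M) (x : M) (v : Fin k → ℝ) :
    infinitesimalAction hsmooth x v = flowField v x := rfl

/-- The torus is commutative, so each of its elements commutes with the flow of `v`. -/
theorem flowField_smul {n : ℕ} {κ : (x : M) → TangentSpace 𝓘(ℝ, E) x [⋀^Fin 2]→L[ℝ] ℝ}
    {φ : (x : M) → TangentSpace 𝓘(ℂ, E) x [⋀^Fin n]→L[ℂ] ℂ} (hsmooth : IsSmoothAction k E M)
    (hpres : IsStructurePreserving k κ φ) (t : Torus k) (v : Fin k → ℝ) (x : M) :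
    (flowField v (t • x) : E) =
      (mfderiv 𝓘(ℝ, E) 𝓘(ℝ, E) (fun y : M => t • y) x : E → E) (flowField v x) := by
  have h0 : HasMFDerivAt 𝓘(ℝ, E) 𝓘(ℝ, E) (fun y : M => t • y) (torusExp ((0 : ℝ) • v) • x)
      (mfderiv 𝓘(ℝ, E) 𝓘(ℝ, E) (fun y : M => t • y) x : E →L[ℝ] E) := by
    rw [zero_smul, torusExp_zero, one_smul]
    exact (MDifferentiableAt.real (hpres.holomorphic t x)).hasMFDerivAt
  have h1 := hasMFDerivAt_flow hsmooth v x 0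
  have h2 := (HasMFDerivAt.comp (f := fun s : ℝ => torusExp (s • v) • x) 0 h0 h1).mfderiv
  have h3 : (fun y : M => t • y) ∘ (fun s : ℝ => torusExp (s • v) • x) =
      fun s : ℝ => torusExp (s • v) • t • x := by
    funext s
    simp only [Function.comp_apply]
    rw [smul_comm]
  rw [h3] at h2
  change (mfderiv 𝓘(ℝ, ℝ) 𝓘(ℝ, E) (fun s : ℝ => torusExp (s • v) • t • x) 0 : ℝ → E) 1 = _
  rw [h2]
  change (mfderiv 𝓘(ℝ, E) 𝓘(ℝ, E) (fun y : M => t • y) x : E → E)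
    ((1 : ℝ) • (flowField v (torusExp ((0 : ℝ) • v) • x) : E)) = _
  rw [one_smul, zero_smul, torusExp_zero, one_smul]

/-- The orbits of a torus action with a moment map are isotropic. -/
theorem isotropic_flowField {n : ℕ} {κ : (x : M) → TangentSpace 𝓘(ℝ, E) x [⋀^Fin 2]→L[ℝ] ℝ}
    {φ : (x : M) → TangentSpace 𝓘(ℂ, E) x [⋀^Fin n]→L[ℂ] ℂ} (hsmooth : IsSmoothAction k E M)
    (hpres : IsStructurePreserving k κ φ) {μ : M → Module.Dual ℝ (Fin k → ℝ)}
    (hμ : IsMomentMap κ μ) (x : M) (v w : Fin k → ℝ) :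
    κ x ![flowField v x, flowField w x] = 0 := by
  have hinv : ∀ (t : Torus k) (w : Fin k → ℝ),
      κ (t • x) ![flowField v (t • x), flowField w (t • x)] =
        κ x ![flowField v x, flowField w x] := by
    intro t w
    rw [← hpres.kahler t x]
    congr 1
    ext i
    fin_cases i
    · exact flowField_smul hsmooth hpres t v x
    · exact flowField_smul hsmooth hpres t w x
  -- By invariance of κ and of the fields, the derivative does not depend on `t`.
  have hder : ∀ (w : Fin k → ℝ) (t : ℝ), HasDerivAt (fun s : ℝ => μ (torusExp (s • w) • x) v)
      (κ x ![flowField v x, flowField w x]) t := by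
    intro w t
    have h0 : MDifferentiableAt 𝓘(ℝ, E) 𝓘(ℝ, ℝ) (fun y => μ y v) (torusExp (t • w) • x) :=
      (hμ.smooth v _).mdifferentiableAt (by simp)
    have h1 := HasMFDerivAt.comp (f := fun s : ℝ => torusExp (s • w) • x) t h0.hasMFDerivAt
      (hasMFDerivAt_flow hsmooth w x t)
    let L : ℝ →L[ℝ] ℝ :=
      (mfderiv 𝓘(ℝ, E) 𝓘(ℝ, ℝ) (fun y => μ y v) (torusExp (t • w) • x) : E →L[ℝ] ℝ).comp
        (ContinuousLinearMap.toSpanSingleton ℝ (flowField w (torusExp (t • w) • x) : E))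
    have h2 : HasFDerivAt (fun s : ℝ => μ (torusExp (s • w) • x) v) L t :=
      hasMFDerivAt_iff_hasFDerivAt.1 h1
    refine h2.hasDerivAt.congr_deriv ?_
    change (mfderiv 𝓘(ℝ, E) 𝓘(ℝ, ℝ) (fun y => μ y v) (torusExp (t • w) • x) : E → ℝ)
      ((1 : ℝ) • (flowField w (torusExp (t • w) • x) : E)) = _
    rw [one_smul, ← hinv (torusExp (t • w)) w]
    exact hμ.deriv v _ _
  let κx : E [⋀^Fin 2]→L[ℝ] ℝ := κ x
  -- By linearity in `w`, standard basis vectors suffice. Their flows have period 2π, so Rolle's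
  -- theorem gives a zero of the constant derivative; a general one-parameter subgroup need not be
  -- periodic.
  have hsingle : (formBilin κx (flowField v x)).comp
      (infinitesimalAction hsmooth x) = 0 := by
    refine LinearMap.pi_ext' fun j => LinearMap.ext_ring ?_
    obtain ⟨t, -, ht⟩ := exists_hasDerivAt_eq_zero Real.two_pi_pos
      (fun s _ => (hder (Pi.single j 1) s).continuousAt.continuousWithinAt)
      (by simp only [zero_smul, torusExp_zero, torusExp_two_pi_smul_single])
      (fun s _ => hder (Pi.single j 1) s)
    exact ht
  exact DFunLike.congr_fun hsingle w

end Action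

end CalabiYauTorus

namespace CalabiYauTorus

/-! ### Regularity of top-degree forms evaluated on vector fields. -/

section TopForm

variable {E : Type*} [NormedAddCommGroup E] [NormedSpace ℂ E] [FiniteDimensional ℂ E] {n : ℕ}

/-- The determinant in a basis, as a continuous alternating map. -/
noncomputable def detCAM (β : Module.Basis (Fin n) ℂ E) : E [⋀^Fin n]→L[ℂ] ℂ :=
  { β.det with
    cont := by
      change Continuous fun m : Fin n → E => β.det m
      simp_rw [Module.Basis.det_apply]
      refine Continuous.matrix_det (continuous_matrix fun i j => ?_)
      exact (LinearMap.continuous_of_finiteDimensional (β.coord i)).comp (continuous_apply j) }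

theorem apply_eq_mul_detCAM (β : Module.Basis (Fin n) ℂ E) (f : E [⋀^Fin n]→L[ℂ] ℂ)
    (m : Fin n → E) : f m = f β * detCAM β m :=
  DFunLike.congr_fun (f.toAlternatingMap.eq_smul_basis_det β) m

theorem differentiableAt_topForm_apply (hE : Module.finrank ℂ E = n) {f : E → E [⋀^Fin n]→L[ℂ] ℂ}
    {m : E → Fin n → E} {y : E} (hf : DifferentiableAt ℂ f y) (hm : DifferentiableAt ℂ m y) :
    DifferentiableAt ℂ (fun z => f z (m z)) y := by
  let β := Module.finBasisOfFinrankEq ℂ E hE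
  -- A top form is its coefficient f(β) times the fixed polynomial map det_β, so the two factors can
  -- be treated separately.
  have h1 : DifferentiableAt ℂ (fun z => f z β) y :=
    (ContinuousAlternatingMap.apply ℂ E ℂ β).differentiableAt.comp y hf
  have h2 : DifferentiableAt ℂ (fun z => detCAM β (m z)) y :=
    ((detCAM β).toContinuousMultilinearMap.contDiff (n := 1)).differentiable one_ne_zero
      |>.differentiableAt.comp y hm
  exact (h1.mul h2).congr_of_eventuallyEq (.of_forall fun z => apply_eq_mul_detCAM β (f z) (m z))

theorem contDiffAt_topForm_apply (hE : Module.finrank ℂ E = n) {f : E → E [⋀^Fin n]→L[ℂ] ℂ}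
    {m : E → Fin n → E} {y : E} (hf : AnalyticAt ℂ f y) (hm : ContDiffAt ℝ ∞ m y) :
    ContDiffAt ℝ ∞ (fun z => f z (m z)) y := by
  let β := Module.finBasisOfFinrankEq ℂ E hE
  have h1 : ContDiffAt ℝ ∞ (fun z => f z β) y :=
    ((ContinuousAlternatingMap.apply ℂ E ℂ β).contDiff.contDiffAt.comp y
      hf.contDiffAt).restrict_scalars ℝ
  have h2 : ContDiffAt ℝ ∞ (fun z => detCAM β (m z)) y :=
    ((detCAM β).toContinuousMultilinearMap.contDiff.restrict_scalars ℝ).contDiffAt.comp y hm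
  exact (h1.mul h2).congr_of_eventuallyEq (.of_forall fun z => apply_eq_mul_detCAM β (f z) (m z))

end TopForm

variable {k : ℕ} {E : Type*} [NormedAddCommGroup E] [NormedSpace ℂ E]
  {M : Type*} [TopologicalSpace M] [ChartedSpace E M] [MulAction (Torus k) M]
  {b : Module.Basis (Fin k) ℝ (Fin k → ℝ)}
  {φ : (x : M) → TangentSpace 𝓘(ℂ, E) x [⋀^Fin (k + 1)]→L[ℂ] ℂ}
  {κ : (x : M) → TangentSpace 𝓘(ℝ, E) x [⋀^Fin 2]→L[ℝ] ℝ}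

/-! ### The contracted form φ' at a point. -/

section Contraction

variable (E) in
/-- The vector fields induced by a basis of the Lie algebra. -/
noncomputable def basisField (b : Module.Basis (Fin k) ℝ (Fin k → ℝ)) (x : M) (j : Fin k) : E :=
  flowField (E := E) (b j) x

/-- The value of a form at a point, as a form on the model space. -/
def formAt {n : ℕ} (φ : (x : M) → TangentSpace 𝓘(ℂ, E) x [⋀^Fin n]→L[ℂ] ℂ) (x : M) :
    E [⋀^Fin n]→L[ℂ] ℂ := φ x

/-- The complex differential of a map between manifolds, as a map between the model spaces. -/
noncomputable def modelDeriv {M N : Type*} [TopologicalSpace M] [ChartedSpace E M]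
    [TopologicalSpace N] [ChartedSpace E N] (f : M → N) (x : M) : E →L[ℂ] E :=
  mfderiv 𝓘(ℂ, E) 𝓘(ℂ, E) f x

/-- The contracted form at a point, as a continuous linear map. -/
noncomputable def contractionForm (b : Module.Basis (Fin k) ℝ (Fin k → ℝ))
    (φ : (x : M) → TangentSpace 𝓘(ℂ, E) x [⋀^Fin (k + 1)]→L[ℂ] ℂ) (x : M) : E →L[ℂ] ℂ :=
  contractCLM (formAt φ x) (basisField E b x ∘ Fin.revPerm)

theorem contraction_eq_contractionForm (x : M) (w : E) :
    contraction b φ x w = contractionForm b φ x w :=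
  (contractCLM_apply (φ := formAt φ x) w).symm

theorem linearIndependent_basisField (hsmooth : IsSmoothAction k E M) {x : M}
    (hx : x ∉ nonRegularSet k E M) : LinearIndependent ℝ (basisField E b x) := by
  have hinj : Function.Injective (infinitesimalAction hsmooth x) := not_not.1 hx
  exact b.linearIndependent.map' (infinitesimalAction hsmooth x) (LinearMap.ker_eq_bot.2 hinj)

/-- At a non-regular point the X_j are dependent over ℝ, hence over ℂ. -/
theorem contractionForm_eq_zero (hsmooth : IsSmoothAction k E M) {x : M}
    (hx : x ∈ nonRegularSet k E M) : contractionForm b φ x = 0 := by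
  refine contractCLM_eq_zero fun h => hx ?_
  have h1 : LinearIndependent ℝ (basisField E b x) :=
    (linearIndependent_equiv Fin.revPerm).1 (h.restrict_scalars' ℝ)
  change Function.Injective (infinitesimalAction hsmooth x)
  exact LinearMap.injective_of_linearIndependent b.span_eq h1

theorem contractionForm_flowField (hsmooth : IsSmoothAction k E M) (v : Fin k → ℝ) (x : M) :
    contractionForm b φ x (flowField v x : E) = 0 := by
  rw [← infinitesimalAction_apply hsmooth, ← b.sum_repr v, map_sum, map_sum]
  refine Finset.sum_eq_zero fun j _ => ?_
  rw [map_smul, ← Complex.coe_smul, map_smul]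
  refine smul_eq_zero_of_right _ (contractCLM_eq_zero_of_mem_span (Submodule.subset_span
    ⟨Fin.revPerm.symm j, ?_⟩))
  rw [Function.comp_apply, Equiv.apply_symm_apply]
  rfl

/-- Both φ and the fields X_j are invariant under the torus. -/
theorem contractionForm_smul (hsmooth : IsSmoothAction k E M)
    (hpres : IsStructurePreserving k κ φ) (t : Torus k) (x : M) (w : E) :
    contractionForm b φ (t • x)
      (modelDeriv (fun y : M => t • y) x w) = contractionForm b φ x w := by
  rw [contractionForm, contractionForm, contractCLM_apply, contractCLM_apply]
  have h := hpres.volume t x (Fin.snoc (α := fun _ => E) (basisField E b x ∘ Fin.revPerm) w)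
  refine Eq.trans ?_ h
  change formAt φ (t • x) _ = formAt φ (t • x) _
  congr 1
  ext i
  cases i using Fin.lastCases with
  | last => simp only [Fin.snoc_last]; rfl
  | cast i =>
    simp only [Fin.snoc_castSucc]
    exact (flowField_smul hsmooth hpres t _ x).trans (mfderiv_real_apply (hpres.holomorphic t x) _)

end Contraction

/-! ### The flow and the contracted form in a chart. -/

section Chart

/-- The flow of an element of the Lie algebra in a chart. -/
noncomputable def chartFlow (e : OpenPartialHomeomorph M E) (v : Fin k → ℝ) (p : ℝ × E) : E :=
  e (torusExp (p.1 • v) • e.symm p.2)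

variable {e : OpenPartialHomeomorph M E} {y : E} (v : Fin k → ℝ)

omit [NormedSpace ℂ E] [ChartedSpace E M] in
theorem chartFlow_zero (hy : y ∈ e.target) : chartFlow e v (0, y) = y := by
  simp [chartFlow, torusExp_zero, e.right_inv hy]

variable (hsmooth : IsSmoothAction k E M)

include hsmooth in
theorem eventually_smul_mem_source (hy : y ∈ e.target) :
    ∀ᶠ t : ℝ in 𝓝 0, torusExp (t • v) • e.symm y ∈ e.source := by
  have h1 : ContinuousAt (fun t : ℝ => torusExp (t • v) • e.symm y) 0 :=
    (hasMFDerivAt_flow hsmooth v (e.symm y) 0).continuousAt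
  refine h1.eventually_mem (e.open_source.mem_nhds ?_)
  rw [zero_smul, torusExp_zero, one_smul]
  exact e.map_target hy

variable [IsManifold 𝓘(ℂ, E) ω M] (he : e ∈ atlas E M)

include hsmooth he in
theorem contDiffAt_chartFlow (hy : y ∈ e.target) : ContDiffAt ℝ ∞ (chartFlow e v) (0, y) := by
  have := isManifold_real E M
  have he' : e ∈ IsManifold.maximalAtlas 𝓘(ℝ, E) ∞ M := IsManifold.subset_maximalAtlas he
  have h1 : ContMDiffAt (𝓘(ℝ, ℝ).prod 𝓘(ℝ, E)) (𝓘(ℝ, Fin k → ℝ).prod 𝓘(ℝ, E)) ∞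
      (fun p : ℝ × E => (p.1 • v, e.symm p.2)) (0, y) :=
    (((contDiff_id.smul contDiff_const : ContDiff ℝ ∞ fun t : ℝ => t • v).contMDiff).contMDiffAt.comp
      _ contMDiffAt_fst).prodMk
      (ContMDiffAt.comp (0, y) (contMDiffAt_symm_of_mem_maximalAtlas he' hy) contMDiffAt_snd)
  have h2 : ContMDiffAt 𝓘(ℝ, E) 𝓘(ℝ, E) ∞ e (torusExp ((0 : ℝ) • v) • e.symm y) := by
    refine contMDiffAt_of_mem_maximalAtlas he' ?_
    rw [zero_smul, torusExp_zero, one_smul]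
    exact e.map_target hy
  have h3 : ContMDiffAt (𝓘(ℝ, ℝ).prod 𝓘(ℝ, E)) 𝓘(ℝ, E) ∞ (chartFlow e v) (0, y) :=
    ContMDiffAt.comp (0, y) h2 (ContMDiffAt.comp (0, y) hsmooth.contMDiffAt h1)
  rw [← modelWithCornersSelf_prod, chartedSpaceSelf_prod] at h3
  exact h3.contDiffAt

include hsmooth he in
theorem contDiffAt_two_chartFlow (hy : y ∈ e.target) : ContDiffAt ℝ 2 (chartFlow e v) (0, y) :=
  (contDiffAt_chartFlow v hsmooth he hy).of_le (WithTop.coe_le_coe.2 (le_top : (2 : ℕ∞) ≤ ⊤))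

include he in
theorem mdifferentiableAt_symm_of_mem_atlas (hy : y ∈ e.target) :
    MDifferentiableAt 𝓘(ℂ, E) 𝓘(ℂ, E) e.symm y := by
  have : IsManifold 𝓘(ℂ, E) 1 M := IsManifold.of_le (n := ω) le_top
  exact mdifferentiableAt_atlas_symm he hy

include hsmooth he in
theorem eventually_differentiableAt_chartFlow (hpres : IsStructurePreserving k κ φ)
    (hy : y ∈ e.target) :
    ∀ᶠ t : ℝ in 𝓝 0, DifferentiableAt ℂ (fun z => chartFlow e v (t, z)) y := by
  have : IsManifold 𝓘(ℂ, E) 1 M := IsManifold.of_le (n := ω) le_top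
  filter_upwards [eventually_smul_mem_source v hsmooth hy] with t ht
  have h1 := mdifferentiableAt_symm_of_mem_atlas he hy
  have h2 := (hpres.holomorphic (torusExp (t • v)) (e.symm y)).comp y h1
  have h3 := MDifferentiableAt.comp y (mdifferentiableAt_atlas he ht) h2
  exact mdifferentiableAt_iff_differentiableAt.1 h3

include hsmooth he in
-- For small times `e.symm` carries the flow in the chart to the orbit, as the orbit has not yet
-- left the chart; differentiate at time 0.
theorem mfderiv_symm_generator (hy : y ∈ e.target) :
    modelDeriv e.symm y (generator (chartFlow e v) y) = (flowField v (e.symm y) : E) := by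
  let L : ℝ →L[ℝ] E := ContinuousLinearMap.toSpanSingleton ℝ (generator (chartFlow e v) y)
  have h1 : HasFDerivAt (fun t : ℝ => chartFlow e v (t, y)) L 0 := by
    have h := ((contDiffAt_chartFlow v hsmooth he hy).differentiableAt (by simp)).hasFDerivAt
    exact (h.comp_hasDerivAt (0 : ℝ)
      ((hasDerivAt_id (0 : ℝ)).prodMk (hasDerivAt_const (0 : ℝ) y))).hasFDerivAt
  have h2 : HasMFDerivAt 𝓘(ℝ, E) 𝓘(ℝ, E) e.symm (chartFlow e v (0, y))
      (mfderiv 𝓘(ℝ, E) 𝓘(ℝ, E) e.symm y : E →L[ℝ] E) := by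
    rw [chartFlow_zero v hy]
    exact (MDifferentiableAt.real (mdifferentiableAt_symm_of_mem_atlas he hy)).hasMFDerivAt
  have h1' : HasMFDerivAt 𝓘(ℝ, ℝ) 𝓘(ℝ, E) (fun t : ℝ => chartFlow e v (t, y)) 0 L :=
    h1.hasMFDerivAt
  have h3 := HasMFDerivAt.comp (f := fun t : ℝ => chartFlow e v (t, y)) 0 h2 h1'
  have h4 : (fun t : ℝ => torusExp (t • v) • e.symm y) =ᶠ[𝓝 0]
      e.symm ∘ fun t : ℝ => chartFlow e v (t, y) := by
    filter_upwards [eventually_smul_mem_source v hsmooth hy] with t ht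
    exact (e.left_inv ht).symm
  have h5 := (h3.congr_of_eventuallyEq h4).mfderiv
  refine (mfderiv_real_apply (mdifferentiableAt_symm_of_mem_atlas he hy) _).symm.trans ?_
  change _ = (mfderiv 𝓘(ℝ, ℝ) 𝓘(ℝ, E) (fun t : ℝ => torusExp (t • v) • e.symm y) 0 : ℝ → E) 1
  rw [h5]
  change _ = (mfderiv 𝓘(ℝ, E) 𝓘(ℝ, E) e.symm y : E → E) ((1 : ℝ) • generator (chartFlow e v) y)
  rw [one_smul]

include hsmooth he in
theorem contDiffAt_generator_chartFlow (hy : y ∈ e.target) :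
    ContDiffAt ℝ ∞ (generator (chartFlow e v)) y :=
  (((contDiffAt_chartFlow v hsmooth he hy).fderiv_right (m := ∞) (by simp)).comp y
    (contDiff_prodMk_right (0 : ℝ)).contDiffAt).clm_apply contDiffAt_const

/-- The contracted form in a chart. -/
noncomputable def chartContraction (b : Module.Basis (Fin k) ℝ (Fin k → ℝ))
    (φ : (x : M) → TangentSpace 𝓘(ℂ, E) x [⋀^Fin (k + 1)]→L[ℂ] ℂ)
    (e : OpenPartialHomeomorph M E) (y : E) : E →L[ℂ] ℂ :=
  (contractionForm b φ (e.symm y)).comp (modelDeriv e.symm y)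

include hsmooth he in
-- This moves the contraction to the model space, where the coefficients of φ and the generators
-- have known regularity.
theorem chartContraction_apply (hy : y ∈ e.target) (w : E) :
    chartContraction b φ e y w = chartRep ℂ e φ y
      (Fin.snoc (α := fun _ => E) (fun j => generator (chartFlow e (b j.rev)) y) w) := by
  change contractCLM (formAt φ (e.symm y)) (basisField E b (e.symm y) ∘ Fin.revPerm)
    (modelDeriv e.symm y w) = formAt φ (e.symm y) _
  rw [contractCLM_apply]
  congr 1
  ext i
  cases i using Fin.lastCases with
  | last => simp only [Fin.snoc_last]; rfl
  | cast i =>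
    simp only [Fin.snoc_castSucc, Function.comp_apply]
    exact (mfderiv_symm_generator (b i.rev) hsmooth he hy).symm

variable [FiniteDimensional ℂ E] (hE : Module.finrank ℂ E = k + 1)

omit [FiniteDimensional ℂ E] in
theorem contDiffAt_snoc {m : Fin k → E → E} (hm : ∀ j, ContDiffAt ℝ ∞ (m j) y) (w : E) :
    ContDiffAt ℝ ∞ (fun z => (Fin.snoc (α := fun _ => E) (fun j => m j z) w : Fin (k + 1) → E)) y := by
  refine contDiffAt_pi.2 fun i => ?_
  cases i using Fin.lastCases with
  | last => simpa using contDiffAt_const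
  | cast i => simpa using hm i

omit [FiniteDimensional ℂ E] in
theorem differentiableAt_snoc {m : Fin k → E → E} (hm : ∀ j, DifferentiableAt ℂ (m j) y) (w : E) :
    DifferentiableAt ℂ
      (fun z => (Fin.snoc (α := fun _ => E) (fun j => m j z) w : Fin (k + 1) → E)) y := by
  refine differentiableAt_pi.2 fun i => ?_
  cases i using Fin.lastCases with
  | last => simp
  | cast i => simpa using hm i

include hsmooth he hE in
theorem contDiffOn_chartContraction (hφ : IsHolomorphicVolumeForm φ) :
    ContDiffOn ℝ ∞ (fun y => (chartContraction b φ e y).restrictScalars ℝ) e.target := by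
  have : FiniteDimensional ℝ E := FiniteDimensional.complexToReal E
  rw [contDiffOn_clm_apply]
  intro w
  refine ContDiffOn.congr (f := fun y => chartRep ℂ e φ y
    (Fin.snoc (α := fun _ => E) (fun j => generator (chartFlow e (b j.rev)) y) w)) ?_
    fun y hy => chartContraction_apply hsmooth he hy w
  intro y hy
  exact (contDiffAt_topForm_apply hE (hφ.holomorphic e he y hy) (contDiffAt_snoc (fun j =>
    contDiffAt_generator_chartFlow (b j.rev) hsmooth he hy) w)).contDiffWithinAt

include hsmooth he hE in
theorem differentiableAt_chartContraction (hφ : IsHolomorphicVolumeForm φ)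
    (hpres : IsStructurePreserving k κ φ) (hy : y ∈ e.target) (w : E) :
    DifferentiableAt ℂ (fun y => chartContraction b φ e y w) y := by
  have h : (fun y => chartContraction b φ e y w) =ᶠ[𝓝 y] fun y => chartRep ℂ e φ y
      (Fin.snoc (α := fun _ => E) (fun j => generator (chartFlow e (b j.rev)) y) w) := by
    filter_upwards [e.open_target.mem_nhds hy] with z hz using chartContraction_apply hsmooth he hz w
  refine DifferentiableAt.congr_of_eventuallyEq ?_ h
  refine differentiableAt_topForm_apply hE (hφ.holomorphic e he y hy).differentiableAt
    (differentiableAt_snoc (fun j => ?_) w)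
  exact differentiableAt_generator (contDiffAt_two_chartFlow (b j.rev) hsmooth he hy)
    (eventually_differentiableAt_chartFlow (b j.rev) hsmooth he hpres hy)

omit [FiniteDimensional ℂ E] in
include hsmooth he in
-- Near `y`, following the chart flow by `e.symm` equals following `e.symm` by the torus element;
-- the chain rule then carries over the invariance of φ'.
theorem eventually_chartContraction_invariant (hpres : IsStructurePreserving k κ φ)
    (hy : y ∈ e.target) :
    ∀ᶠ t : ℝ in 𝓝 0, ((chartContraction b φ e (chartFlow e v (t, y))).restrictScalars ℝ).comp
      (fderiv ℝ (fun z => chartFlow e v (t, z)) y) =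
        (chartContraction b φ e y).restrictScalars ℝ := by
  filter_upwards [eventually_smul_mem_source v hsmooth hy,
    eventually_differentiableAt_chartFlow v hsmooth he hpres hy] with t ht hd
  have h1 := mdifferentiableAt_symm_of_mem_atlas he hy
  have h2 := (hpres.holomorphic (torusExp (t • v)) (e.symm y)).hasMFDerivAt.comp y h1.hasMFDerivAt
  have hz : chartFlow e v (t, y) ∈ e.target := e.map_source ht
  let L : E →L[ℂ] E := fderiv ℂ (fun z => chartFlow e v (t, z)) y
  have h3 : HasFDerivAt (fun z => chartFlow e v (t, z)) L y := hd.hasFDerivAt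
  have h3' : HasMFDerivAt 𝓘(ℂ, E) 𝓘(ℂ, E) (fun z => chartFlow e v (t, z)) y L := h3.hasMFDerivAt
  have h4 := HasMFDerivAt.comp (f := fun z => chartFlow e v (t, z)) y
    (mdifferentiableAt_symm_of_mem_atlas he hz).hasMFDerivAt h3'
  have h5 : (fun x : M => torusExp (t • v) • x) ∘ e.symm =ᶠ[𝓝 y]
      e.symm ∘ fun z => chartFlow e v (t, z) := by
    have hc : ContinuousAt (fun z => torusExp (t • v) • e.symm z) y := h2.continuousAt
    filter_upwards [hc.eventually_mem (e.open_source.mem_nhds ht)] with z hz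
    exact (e.left_inv hz).symm
  have h6 := hasMFDerivAt_unique h2 (h4.congr_of_eventuallyEq h5)
  ext w
  rw [hd.fderiv_restrictScalars ℝ]
  have h8 : e.symm (chartFlow e v (t, y)) = torusExp (t • v) • e.symm y := e.left_inv ht
  change contractionForm b φ (e.symm (chartFlow e v (t, y)))
    (modelDeriv e.symm (chartFlow e v (t, y)) (L w)) =
    contractionForm b φ (e.symm y) (modelDeriv e.symm y w)
  rw [← contractionForm_smul hsmooth hpres (torusExp (t • v)) (e.symm y) (modelDeriv e.symm y w), h8]
  congr 1
  exact (DFunLike.congr_fun h6 w).symm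

end Chart

end CalabiYauTorus

namespace CalabiYauTorus

variable {k : ℕ} {E : Type*} [NormedAddCommGroup E] [NormedSpace ℂ E] [FiniteDimensional ℂ E]
  {M : Type*} [TopologicalSpace M] [ChartedSpace E M] [IsManifold 𝓘(ℂ, E) ω M]
  [MulAction (Torus k) M] {b : Module.Basis (Fin k) ℝ (Fin k → ℝ)}
  {φ : (x : M) → TangentSpace 𝓘(ℂ, E) x [⋀^Fin (k + 1)]→L[ℂ] ℂ}
  {κ : (x : M) → TangentSpace 𝓘(ℝ, E) x [⋀^Fin 2]→L[ℝ] ℝ}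
  {μ : M → Module.Dual ℝ (Fin k → ℝ)}

/-! ### Closedness of the contracted form. -/

section Closed

variable {e : OpenPartialHomeomorph M E} (he : e ∈ atlas E M) {y : E}
  (hE : Module.finrank ℂ E = k + 1) (hκ : IsKahlerForm κ) (hφ : IsHolomorphicVolumeForm φ)
  (hsmooth : IsSmoothAction k E M) (hpres : IsStructurePreserving k κ φ) (hμ : IsMomentMap κ μ)

/-- The contracted form in a chart, as a real form with complex values. -/
noncomputable def realChartContraction (b : Module.Basis (Fin k) ℝ (Fin k → ℝ))
    (φ : (x : M) → TangentSpace 𝓘(ℂ, E) x [⋀^Fin (k + 1)]→L[ℂ] ℂ)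
    (e : OpenPartialHomeomorph M E) (y : E) : E →L[ℝ] ℂ :=
  (chartContraction b φ e y).restrictScalars ℝ

include he hE hφ hsmooth in
theorem differentiableAt_realChartContraction (hy : y ∈ e.target) :
    DifferentiableAt ℝ (realChartContraction b φ e) y :=
  ((contDiffOn_chartContraction hsmooth he hE hφ).contDiffAt
    (e.open_target.mem_nhds hy)).differentiableAt (by simp)

omit [FiniteDimensional ℂ E] [IsManifold 𝓘(ℂ, E) ω M] in
include hκ hsmooth hpres hμ in
theorem linearIndependent_complex_basisField {x : M} (hx : x ∉ nonRegularSet k E M) :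
    LinearIndependent ℂ (basisField E b x) :=
  linearIndependent_complex_of_isotropic (κ := (κ x : E [⋀^Fin 2]→L[ℝ] ℝ))
    (fun w hw => hκ.pos x w hw) (linearIndependent_basisField hsmooth hx)
    fun i j => isotropic_flowField hsmooth hpres hμ x (b i) (b j)

include he hE hφ hsmooth hpres in
-- Holomorphy of φ' makes its derivative complex linear in both arguments, so that dφ' can be tested
-- on a family independent over ℂ only.
theorem fderiv_realChartContraction_apply (hy : y ∈ e.target) (u w : E) :
    fderiv ℝ (realChartContraction b φ e) y u w =
      fderiv ℂ (fun z => chartContraction b φ e z w) y u := by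
  have h1 := (differentiableAt_realChartContraction (b := b) he hE hφ hsmooth hy).hasFDerivAt.clm_apply
    (hasFDerivAt_const w y)
  have h2 := (differentiableAt_chartContraction (b := b) hsmooth he hE hφ hpres hy
    w).hasFDerivAt.restrictScalars ℝ
  have h3 := DFunLike.congr_fun (h1.unique h2) u
  simpa using h3

/-- The complex derivative of the contracted form in a chart, as a bilinear map. -/
noncomputable def derivBilin (he : e ∈ atlas E M) (hE : Module.finrank ℂ E = k + 1)
    (hφ : IsHolomorphicVolumeForm φ) (hsmooth : IsSmoothAction k E M)
    (hpres : IsStructurePreserving k κ φ) (b : Module.Basis (Fin k) ℝ (Fin k → ℝ))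
    (hy : y ∈ e.target) : E →ₗ[ℂ] E →ₗ[ℂ] ℂ :=
  LinearMap.mk₂ ℂ (fun u w => fderiv ℂ (fun z => chartContraction b φ e z w) y u)
    (fun u u' w => map_add _ u u') (fun c u w => map_smul _ c u)
    (fun u w w' => by
      simp only [map_add]
      have hd := differentiableAt_chartContraction (b := b) hsmooth he hE hφ hpres hy
      rw [fderiv_fun_add (hd w) (hd w')]
      rfl)
    (fun c u w => by
      simp only [map_smul]
      have hd := differentiableAt_chartContraction (b := b) hsmooth he hE hφ hpres hy
      rw [fderiv_fun_const_smul (hd w)]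
      rfl)

include he hE hκ hφ hsmooth hpres hμ in
theorem fderiv_realChartContraction_symm_of_regular (hy : y ∈ e.target)
    (hreg : e.symm y ∉ nonRegularSet k E M) (u w : E) :
    fderiv ℝ (realChartContraction b φ e) y u w = fderiv ℝ (realChartContraction b φ e) y w u := by
  let C := derivBilin he hE hφ hsmooth hpres b hy
  have hC : ∀ u w, fderiv ℝ (realChartContraction b φ e) y u w = C u w :=
    fderiv_realChartContraction_apply he hE hφ hsmooth hpres hy
  have hX : LinearIndependent ℂ fun j => generator (chartFlow e (b j)) y := by
    refine LinearIndependent.of_comp (modelDeriv e.symm y).toLinearMap ?_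
    have h : (modelDeriv e.symm y).toLinearMap ∘ (fun j => generator (chartFlow e (b j)) y) =
        basisField E b (e.symm y) :=
      funext fun j => mfderiv_symm_generator (b j) hsmooth he hy
    rw [h]
    exact linearIndependent_complex_basisField hκ hsmooth hpres hμ hreg
  -- `C - C.flip` is dφ' in the chart; Cartan's formula puts the k generators in its radical.
  have h := bilin_eq_zero_of_radical hE hX (C - C.flip) (fun u => sub_self _) (fun j w => ?_) u w
  · rw [hC, hC]
    exact sub_eq_zero.1 h
  · change C _ _ - C _ _ = 0
    rw [sub_eq_zero, ← hC, ← hC]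
    refine fderiv_symm_of_invariant (contDiffAt_two_chartFlow (b j) hsmooth he hy) ?_
      (differentiableAt_realChartContraction he hE hφ hsmooth hy)
      (eventually_chartContraction_invariant (b j) hsmooth he hpres hy) ?_ w
    · filter_upwards [e.open_target.mem_nhds hy] with z hz using chartFlow_zero (b j) hz
    · filter_upwards [e.open_target.mem_nhds hy] with z hz
      change contractionForm b φ (e.symm z) (modelDeriv e.symm z _) = 0
      rw [mfderiv_symm_generator (b j) hsmooth he hz]
      exact contractionForm_flowField hsmooth (b j) _

include he hE hκ hφ hsmooth hpres hμ in
/-- The contracted form is closed. -/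
theorem fderiv_realChartContraction_symm (hy : y ∈ e.target) (u w : E) :
    fderiv ℝ (realChartContraction b φ e) y u w = fderiv ℝ (realChartContraction b φ e) y w u := by
  by_cases hN : ∀ᶠ z in 𝓝 y, e.symm z ∈ nonRegularSet k E M
  · have h0 : realChartContraction b φ e =ᶠ[𝓝 y] fun _ => 0 := by
      filter_upwards [hN] with z hz
      rw [realChartContraction, chartContraction, contractionForm_eq_zero hsmooth hz]
      rfl
    rw [h0.fderiv_eq]
    simp
  · have hD : ContinuousAt (fderiv ℝ (realChartContraction b φ e)) y :=
      (((contDiffOn_chartContraction (b := b) hsmooth he hE hφ).fderiv_of_isOpen (m := 0)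
        e.open_target (by simp)).continuousOn).continuousAt (e.open_target.mem_nhds hy)
    have hc : ContinuousAt (fun z => fderiv ℝ (realChartContraction b φ e) z u w -
        fderiv ℝ (realChartContraction b φ e) z w u) y :=
      ((hD.clm_apply continuousAt_const).clm_apply continuousAt_const).sub
        ((hD.clm_apply continuousAt_const).clm_apply continuousAt_const)
    have hf : ∃ᶠ z in 𝓝 y, fderiv ℝ (realChartContraction b φ e) z u w -
        fderiv ℝ (realChartContraction b φ e) z w u ∈ ({0} : Set ℂ) := by
      refine ((Filter.not_eventually.1 hN).and_eventually
        (e.open_target.eventually_mem hy)).mono fun z hz => ?_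
      exact sub_eq_zero.2 (fderiv_realChartContraction_symm_of_regular he hE hκ hφ hsmooth hpres hμ
        hz.2 hz.1 u w)
    exact sub_eq_zero.1 (isClosed_singleton.mem_of_frequently_of_tendsto hf hc)

end Closed

/-! ### The holomorphic potential. -/

section Potential

/-- The composition of the contracted form with a real linear function, as a real 1-form. -/
noncomputable def realForm (b : Module.Basis (Fin k) ℝ (Fin k → ℝ))
    (φ : (x : M) → TangentSpace 𝓘(ℂ, E) x [⋀^Fin (k + 1)]→L[ℂ] ℂ) (l : ℂ →L[ℝ] ℝ) (x : M) :
    TangentSpace 𝓘(ℝ, E) x [⋀^Fin 1]→L[ℝ] ℝ :=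
  ContinuousAlternatingMap.ofSubsingleton ℝ E ℝ (0 : Fin 1)
    (l.comp ((contractionForm b φ x).restrictScalars ℝ))

variable {e : OpenPartialHomeomorph M E}

omit [FiniteDimensional ℂ E] in
theorem chartRep_realForm (he : e ∈ atlas E M) {y : E} (hy : y ∈ e.target) (l : ℂ →L[ℝ] ℝ) :
    chartRep ℝ e (realForm b φ l) y =
      ContinuousAlternatingMap.ofSubsingletonLIE (𝕜 := ℝ) (E := E) (F := ℝ) (0 : Fin 1)
        (l.comp (realChartContraction b φ e y)) := by
  ext m
  change l (contractionForm b φ (e.symm y)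
    ((mfderiv 𝓘(ℝ, E) 𝓘(ℝ, E) e.symm y : E → E) (m 0))) =
    l (contractionForm b φ (e.symm y) (modelDeriv e.symm y (m 0)))
  rw [mfderiv_real_apply (mdifferentiableAt_symm_of_mem_atlas he hy)]
  rfl

variable (hE : Module.finrank ℂ E = k + 1) (hκ : IsKahlerForm κ) (hφ : IsHolomorphicVolumeForm φ)
  (hsmooth : IsSmoothAction k E M) (hpres : IsStructurePreserving k κ φ) (hμ : IsMomentMap κ μ)

include hE hφ hsmooth in
theorem isSmoothForm_realForm (l : ℂ →L[ℝ] ℝ) : IsSmoothForm (realForm b φ l) := by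
  intro e he
  refine ContDiffOn.congr ?_ fun y hy => chartRep_realForm he hy l
  exact (ContinuousAlternatingMap.ofSubsingletonLIE (𝕜 := ℝ) (E := E) (F := ℝ) (0 : Fin 1)).contDiff.comp_contDiffOn
    (contDiffOn_const.clm_comp (contDiffOn_chartContraction hsmooth he hE hφ))

include hE hκ hφ hsmooth hpres hμ in
theorem isClosedForm_realForm (l : ℂ →L[ℝ] ℝ) : IsClosedForm (realForm b φ l) := by
  intro e he y hy
  have hd := differentiableAt_realChartContraction (b := b) he hE hφ hsmooth hy
  have hev : chartRep ℝ e (realForm b φ l) =ᶠ[𝓝 y] fun z =>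
      ContinuousAlternatingMap.ofSubsingletonLIE (𝕜 := ℝ) (E := E) (F := ℝ) (0 : Fin 1)
        (l.comp (realChartContraction b φ e z)) := by
    filter_upwards [e.open_target.mem_nhds hy] with z hz using chartRep_realForm he hz l
  rw [hev.extDeriv_eq]
  ext m
  have hl : DifferentiableAt ℝ (fun z => l.comp (realChartContraction b φ e z)) y :=
    (differentiableAt_const l).clm_comp hd
  have hf : ∀ u w : E, fderiv ℝ (fun z => l (realChartContraction b φ e z w)) y u =
      l (fderiv ℝ (realChartContraction b φ e) y u w) := by
    intro u w
    have h1 := l.hasFDerivAt.comp y (hd.hasFDerivAt.clm_apply (hasFDerivAt_const w y))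
    refine (DFunLike.congr_fun h1.fderiv u).trans ?_
    simp
  refine (extDeriv_apply ((ContinuousAlternatingMap.ofSubsingletonLIE (𝕜 := ℝ) (E := E)
    (F := ℝ) (0 : Fin 1)).differentiableAt.comp y hl) m).trans ?_
  rw [Fin.sum_univ_two]
  change (-1 : ℤ) ^ 0 • fderiv ℝ (fun z => l (realChartContraction b φ e z (m 1))) y (m 0) +
    (-1 : ℤ) ^ 1 • fderiv ℝ (fun z => l (realChartContraction b φ e z (m 0))) y (m 1) = 0
  rw [hf, hf, fderiv_realChartContraction_symm he hE hκ hφ hsmooth hpres hμ hy]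
  simp

include hE hκ hφ hsmooth hpres hμ in
theorem exists_isPotential (hH1 : H1Vanishes E M) : ∃ f : M → ℂ, IsPotential (E := E) b φ f := by
  obtain ⟨h₁, hs₁, hd₁⟩ := hH1 (realForm b φ Complex.reCLM)
    (isSmoothForm_realForm hE hφ hsmooth _)
    (isClosedForm_realForm hE hκ hφ hsmooth hpres hμ _)
  obtain ⟨h₂, hs₂, hd₂⟩ := hH1 (realForm b φ Complex.imCLM)
    (isSmoothForm_realForm hE hφ hsmooth _)
    (isClosedForm_realForm hE hκ hφ hsmooth hpres hμ _)
  -- The primitives of Re φ' and Im φ' combine to a function with real differential φ', which is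
  -- ℂ-linear.
  have hf : ∀ x, HasMFDerivAt 𝓘(ℂ, E) 𝓘(ℂ, ℂ)
      (fun x => Complex.equivRealProdCLM.symm (h₁ x, h₂ x)) x (contractionForm (E := E) b φ x) := by
    intro x
    refine HasMFDerivAt.of_real ?_
    have h1 := ((hs₁ x).mdifferentiableAt (by simp)).hasMFDerivAt
    have h2 := ((hs₂ x).mdifferentiableAt (by simp)).hasMFDerivAt
    have h12 : HasMFDerivAt 𝓘(ℝ, E) 𝓘(ℝ, ℝ × ℝ) (fun x => (h₁ x, h₂ x)) x
        ((mfderiv 𝓘(ℝ, E) 𝓘(ℝ, ℝ) h₁ x : E →L[ℝ] ℝ).prod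
          (mfderiv 𝓘(ℝ, E) 𝓘(ℝ, ℝ) h₂ x : E →L[ℝ] ℝ)) :=
      ⟨h1.1.prodMk h2.1, HasFDerivWithinAt.prodMk h1.2 h2.2⟩
    have h3 := HasMFDerivAt.comp (f := fun x => (h₁ x, h₂ x)) x
      (Complex.equivRealProdCLM.symm : ℝ × ℝ →L[ℝ] ℂ).hasMFDerivAt h12
    refine h3.congr_mfderiv ?_
    ext w
    change Complex.equivRealProdCLM.symm ((mfderiv 𝓘(ℝ, E) 𝓘(ℝ, ℝ) h₁ x : E → ℝ) w,
      (mfderiv 𝓘(ℝ, E) 𝓘(ℝ, ℝ) h₂ x : E → ℝ) w) = contractionForm b φ x w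
    have e1 : (mfderiv 𝓘(ℝ, E) 𝓘(ℝ, ℝ) h₁ x : E → ℝ) w = (contractionForm b φ x w).re := hd₁ x w
    have e2 : (mfderiv 𝓘(ℝ, E) 𝓘(ℝ, ℝ) h₂ x : E → ℝ) w = (contractionForm b φ x w).im := hd₂ x w
    rw [e1, e2]
    exact Complex.ext (by simp) (by simp)
  refine ⟨_, fun x => (hf x).mdifferentiableAt, fun x w => ?_⟩
  rw [(hf x).mfderiv]
  exact (contraction_eq_contractionForm (E := E) x w).symm

variable {f : M → ℂ} (hf : IsPotential (E := E) b φ f)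

omit [FiniteDimensional ℂ E] [IsManifold 𝓘(ℂ, E) ω M] in
include hf in
theorem hasMFDerivAt_potential (x : M) :
    HasMFDerivAt 𝓘(ℂ, E) 𝓘(ℂ, ℂ) f x (contractionForm (E := E) b φ x) := by
  refine (hf.1 x).hasMFDerivAt.congr_mfderiv ?_
  ext w
  exact (hf.2 x w).trans (contraction_eq_contractionForm (E := E) x w)

include hE hφ hsmooth hf in
-- A potential is only assumed differentiable, but its differential is the smooth form φ'.
theorem contMDiff_potential : ContMDiff 𝓘(ℝ, E) 𝓘(ℝ, ℂ) ∞ f := by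
  have := isManifold_real E M
  intro x
  let e := chartAt E x
  have he : e ∈ atlas E M := chart_mem_atlas E x
  have he' : e ∈ IsManifold.maximalAtlas 𝓘(ℝ, E) ∞ M := IsManifold.subset_maximalAtlas he
  have hx : x ∈ e.source := mem_chart_source E x
  have hder : ∀ y ∈ e.target, HasFDerivAt (f ∘ e.symm) (realChartContraction b φ e y) y := by
    intro y hy
    have h1 := (hasMFDerivAt_potential hf (e.symm y)).comp y
      (mdifferentiableAt_symm_of_mem_atlas he hy).hasMFDerivAt
    have h2 : HasMFDerivAt 𝓘(ℂ, E) 𝓘(ℂ, ℂ) (f ∘ e.symm) y (chartContraction (E := E) b φ e y) := h1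
    exact (hasMFDerivAt_iff_hasFDerivAt.1 h2).restrictScalars ℝ
  have hcd : ContDiffOn ℝ ∞ (f ∘ e.symm) e.target := by
    rw [contDiffOn_infty_iff_fderiv_of_isOpen e.open_target]
    exact ⟨fun y hy => (hder y hy).differentiableAt.differentiableWithinAt,
      (contDiffOn_chartContraction hsmooth he hE hφ).congr fun y hy => (hder y hy).fderiv⟩
  have h3 : ContMDiffAt 𝓘(ℝ, E) 𝓘(ℝ, ℂ) ∞ ((f ∘ e.symm) ∘ e) x :=
    ((hcd.contDiffAt (e.open_target.mem_nhds (e.map_source hx))).contMDiffAt).comp x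
      (contMDiffAt_of_mem_maximalAtlas he' hx)
  refine h3.congr_of_eventuallyEq ?_
  filter_upwards [e.open_source.mem_nhds hx] with z hz
  simp [e.left_inv hz]

end Potential

end CalabiYauTorus

namespace CalabiYauTorus

variable {k : ℕ} {E : Type*} [NormedAddCommGroup E] [NormedSpace ℂ E]
  {M : Type*} [TopologicalSpace M] [ChartedSpace E M] [IsManifold 𝓘(ℂ, E) ω M]
  [MulAction (Torus k) M] {b : Module.Basis (Fin k) ℝ (Fin k → ℝ)}
  {φ : (x : M) → TangentSpace 𝓘(ℂ, E) x [⋀^Fin (k + 1)]→L[ℂ] ℂ}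
  {κ : (x : M) → TangentSpace 𝓘(ℝ, E) x [⋀^Fin 2]→L[ℝ] ℝ}
  {μ : M → Module.Dual ℝ (Fin k → ℝ)} {f : M → ℂ}

/-! ### Fibers of (μ, ξ) and images of the strata. -/

section Fibration

/-- The value of a real form at a point, as a form on the model space. -/
noncomputable def realFormAt {n : ℕ} (κ : (x : M) → TangentSpace 𝓘(ℝ, E) x [⋀^Fin n]→L[ℝ] ℝ) (x : M) :
    E [⋀^Fin n]→L[ℝ] ℝ := κ x

variable (hsmooth : IsSmoothAction k E M) (hμ : IsMomentMap κ μ) (hf : IsPotential (E := E) b φ f)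

omit [IsManifold 𝓘(ℂ, E) ω M] in
include hf in
theorem hasMFDerivAt_im_potential (x : M) :
    HasMFDerivAt 𝓘(ℝ, E) 𝓘(ℝ, ℝ) (fun y => (f y).im) x
      (Complex.imCLM.comp ((contractionForm (E := E) b φ x).restrictScalars ℝ)) :=
  HasMFDerivAt.comp (f := f) x Complex.imCLM.hasMFDerivAt
    (HasMFDerivAt.real (hasMFDerivAt_potential hf x))

omit [IsManifold 𝓘(ℂ, E) ω M] in
include hμ hf in
theorem mfderiv_fibrationMap_apply {x : M}
    (hF : MDifferentiableAt 𝓘(ℝ, E) 𝓘(ℝ, Fin (k + 1) → ℝ) (fibrationMap b μ f) x) (w : E) :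
    (mfderiv 𝓘(ℝ, E) 𝓘(ℝ, Fin (k + 1) → ℝ) (fibrationMap b μ f) x : E → (Fin (k + 1) → ℝ)) w =
      fibrationCLM (realFormAt κ x) (formAt φ x) (basisField E b x)
        (basisField E b x ∘ Fin.revPerm) w := by
  have hcomp : ∀ i, HasMFDerivAt 𝓘(ℝ, E) 𝓘(ℝ, ℝ) (fun y => fibrationMap b μ f y i) x
      ((ContinuousLinearMap.proj (R := ℝ) (φ := fun _ : Fin (k + 1) => ℝ) i).comp
        (mfderiv 𝓘(ℝ, E) 𝓘(ℝ, Fin (k + 1) → ℝ) (fibrationMap b μ f) x :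
          E →L[ℝ] (Fin (k + 1) → ℝ))) := fun i =>
    HasMFDerivAt.comp (f := fibrationMap b μ f) x
      (ContinuousLinearMap.proj (R := ℝ) (φ := fun _ : Fin (k + 1) => ℝ) i).hasMFDerivAt
      hF.hasMFDerivAt
  refine funext fun i => ?_
  cases i using Fin.lastCases with
  | last =>
    rw [fibrationCLM_apply_last]
    have h1 := (hasMFDerivAt_im_potential hf x).congr_of_eventuallyEq
      (f₁ := fun y => fibrationMap b μ f y (Fin.last k))
      (.of_forall fun y => Fin.snoc_last (α := fun _ => ℝ) _ _)
    exact DFunLike.congr_fun (hasMFDerivAt_unique (hcomp (Fin.last k)) h1) w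
  | cast j =>
    rw [fibrationCLM_apply_castSucc]
    have h1 := (hcomp j.castSucc).congr_of_eventuallyEq (f₁ := fun y => μ y (b j))
      (.of_forall fun y =>
        (Fin.snoc_castSucc (α := fun _ => ℝ) (f y).im (fun j => μ y (b j)) j).symm)
    exact (DFunLike.congr_fun h1.mfderiv w).symm.trans (hμ.deriv (b j) x w)

variable [FiniteDimensional ℂ E] (hE : Module.finrank ℂ E = k + 1) (hφ : IsHolomorphicVolumeForm φ)

include hsmooth hμ hf hE hφ in
theorem contMDiff_fibrationMap :
    ContMDiff 𝓘(ℝ, E) 𝓘(ℝ, Fin (k + 1) → ℝ) ∞ (fibrationMap b μ f) := by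
  rw [contMDiff_pi_space]
  intro i
  cases i using Fin.lastCases with
  | last =>
    simp only [fibrationMap, Fin.snoc_last]
    exact Complex.imCLM.contDiff.contMDiff.comp (contMDiff_potential hE hφ hsmooth hf)
  | cast j =>
    simp only [fibrationMap, Fin.snoc_castSucc]
    exact hμ.smooth (b j)

include hsmooth hμ hf hE hφ in
theorem isSpecialLagrangian_fiber (hκ : IsKahlerForm κ) (hpres : IsStructurePreserving k κ φ)
    {p : Fin (k + 1) → ℝ} (hp : ∀ x, fibrationMap b μ f x = p → x ∉ nonRegularSet k E M) :
    IsSpecialLagrangian κ φ (fibrationMap b μ f ⁻¹' {p}) := by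
  have := isManifold_real E M
  have hF := contMDiff_fibrationMap hsmooth hμ hf hE hφ
  have hFd : ∀ x, MDifferentiableAt 𝓘(ℝ, E) 𝓘(ℝ, Fin (k + 1) → ℝ) (fibrationMap b μ f) x :=
    fun x => (hF x).mdifferentiableAt (by simp)
  have hpos : ∀ (x : M) (w : E), w ≠ 0 → 0 < (realFormAt κ x) ![w, Complex.I • w] :=
    fun x w hw => hκ.pos x w hw
  have hiso : ∀ (x : M) (i j : Fin k),
      (realFormAt κ x) ![basisField E b x i, basisField E b x j] = 0 :=
    fun x i j => isotropic_flowField hsmooth hpres hμ x (b i) (b j)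
  have hne : ∀ x, formAt φ x ≠ 0 := hφ.ne_zero
  have hind : ∀ x, fibrationMap b μ f x = p → LinearIndependent ℝ (basisField E b x) :=
    fun x hx => linearIndependent_basisField hsmooth (hp x hx)
  -- Along a curve in the fiber the map is constant near time 0, so the velocity is in the kernel of
  -- the differential.
  have htan : ∀ x, fibrationMap b μ f x = p →
      ∀ u ∈ tangentVectors (E := E) (fibrationMap b μ f ⁻¹' {p}) x,
      fibrationCLM (realFormAt κ x) (formAt φ x) (basisField E b x)
        (basisField E b x ∘ Fin.revPerm) u = 0 := by
    rintro x - u ⟨γ, rfl, hγ, hγL, hγu⟩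
    refine (mfderiv_fibrationMap_apply hμ hf (hFd _) u).symm.trans ?_
    have h1 := HasMFDerivAt.comp (0 : ℝ) (hFd (γ 0)).hasMFDerivAt
      (hγ.mdifferentiableAt (by simp)).hasMFDerivAt
    have h2 : HasMFDerivAt 𝓘(ℝ, ℝ) 𝓘(ℝ, Fin (k + 1) → ℝ) (fibrationMap b μ f ∘ γ) 0
        (0 : ℝ →L[ℝ] (Fin (k + 1) → ℝ)) :=
      (hasMFDerivAt_const p (0 : ℝ)).congr_of_eventuallyEq hγL
    rw [← hγu]
    exact DFunLike.congr_fun (hasMFDerivAt_unique h1 h2) (1 : ℝ)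
  refine ⟨?_, ?_, ?_⟩
  · refine isSubmanifold_preimage ?_ hF fun x hx => ?_
    · rw [finrank_real_of_complex, hE]
      ring
    · intro z
      obtain ⟨w, hw⟩ := fibrationCLM_surjective hE (hpos x) (hind x hx) (hiso x) (hne x)
        Fin.revPerm z
      exact ⟨w, (mfderiv_fibrationMap_apply hμ hf (hFd x) w).trans hw⟩
  · intro x hx u hu w hw
    exact lagrangian_ker_fibrationCLM hE (hpos x) (hind x hx) (hiso x) (hne x) Fin.revPerm
      (htan x hx u hu) (htan x hx w hw)
  · intro x hx u hu
    exact special_ker_fibrationCLM hE (hpos x) (hind x hx) (hiso x) (hne x) Fin.revPerm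
      fun i => htan x hx (u i) (hu i)

omit [FiniteDimensional ℂ E] in
include hsmooth hμ hf in
/-- The image of a stratum of non-regular points lies in a plane of codimension two. -/
theorem exists_isCodimTwoPlane {S : Set M} (hS : S ⊆ nonRegularSet k E M) (hconn : IsConnected S)
    {d : ℕ} (hsub : IsSubmanifold (E := E) d S) (hstab : HasPosDimStabilizer k S) :
    ∃ Q : AffineSubspace ℝ (Fin (k + 1) → ℝ), IsCodimTwoPlane Q ∧
      ∀ x ∈ S, fibrationMap b μ f x ∈ Q := by
  have := isManifold_real E M
  obtain ⟨x₀, hx₀⟩ := hconn.nonempty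
  obtain ⟨v, hv, hstab⟩ := hstab
  have hX : ∀ x ∈ S, (flowField v x : E) = 0 := by
    intro x hx
    have h : (fun t : ℝ => torusExp (t • v) • x) = fun _ => x :=
      funext fun t => (mem_fixingSubgroup_iff (Torus k)).1 (hstab t) x hx
    change (mfderiv 𝓘(ℝ, ℝ) 𝓘(ℝ, E) (fun t : ℝ => torusExp (t • v) • x) 0 : ℝ → E) 1 = 0
    rw [h, mfderiv_const]
    rfl
  -- At points of `S` the whole differential of μ(v) vanishes, being κ(X_v, ·) with X_v = 0.
  have hμS : ∀ x ∈ S, μ x v = μ x₀ v := by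
    intro x hx
    refine eqOn_of_mfderiv_eq_zero (g := fun x => μ x v) hsub hconn.isPreconnected
      (fun x => (hμ.smooth v x).mdifferentiableAt (by simp)) (fun y hy w => ?_) hx hx₀
    refine (hμ.deriv v y w).trans ?_
    exact (congrArg (fun z : E => formBilin (realFormAt κ y) z w) (hX y hy)).trans
      (LinearMap.map_zero₂ _ _)
  -- Here non-regularity is used: φ' = 0 at every point of `S`.
  have hξS : ∀ x ∈ S, (f x).im = (f x₀).im := by
    intro x hx
    refine eqOn_of_mfderiv_eq_zero (g := fun x => (f x).im) hsub hconn.isPreconnected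
      (fun x => (hasMFDerivAt_im_potential hf x).mdifferentiableAt) (fun y hy w => ?_) hx hx₀
    rw [(hasMFDerivAt_im_potential hf y).mfderiv, contractionForm_eq_zero hsmooth (hS hy)]
    rfl
  -- In the coordinates given by `b`, `l₁` is evaluation of the moment map at `v`.
  let l₁ : (Fin (k + 1) → ℝ) →ₗ[ℝ] ℝ :=
    ∑ j : Fin k, b.repr v j • LinearMap.proj (R := ℝ) (φ := fun _ : Fin (k + 1) => ℝ) j.castSucc
  let l : (Fin (k + 1) → ℝ) →ₗ[ℝ] ℝ × ℝ := l₁.prod (LinearMap.proj (Fin.last k))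
  have hl₁ : ∀ p, l₁ p = ∑ j, b.repr v j * p j.castSucc := fun p => by
    simp [l₁]
  have hl : ∀ x, l (fibrationMap b μ f x) = (μ x v, (f x).im) := by
    intro x
    refine Prod.ext ?_ ?_
    · change l₁ _ = _
      rw [hl₁]
      conv_rhs => rw [← b.sum_repr v, map_sum]
      simp only [fibrationMap, Fin.snoc_castSucc, map_smul, smul_eq_mul]
    · change fibrationMap b μ f x (Fin.last k) = _
      simp [fibrationMap]
  -- As v ≠ 0, some coordinate of `v` is nonzero; it adjusts the first value, and the free last
  -- coordinate gives the second.
  have hsurj : Function.Surjective l := by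
    obtain ⟨j, hj⟩ : ∃ j, b.repr v j ≠ 0 := by
      by_contra! h
      exact hv (b.repr.map_eq_zero_iff.1 (Finsupp.ext h))
    rintro ⟨r, s⟩
    refine ⟨Fin.snoc (α := fun _ => ℝ) (Pi.single j (r / b.repr v j)) s, Prod.ext ?_ ?_⟩
    · change l₁ _ = _
      rw [hl₁, Finset.sum_eq_single j (fun i _ hi => by simp [hi]) (by simp)]
      simp [mul_div_cancel₀ _ hj]
    · change Fin.snoc (α := fun _ => ℝ) _ s (Fin.last k) = s
      simp
  refine ⟨AffineSubspace.mk' (fibrationMap b μ f x₀) (LinearMap.ker l),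
    ⟨AffineSubspace.mk'_nonempty _ _, ?_⟩, fun x hx => ?_⟩
  · have h := l.finrank_range_add_finrank_ker
    rw [LinearMap.range_eq_top.2 hsurj, finrank_top] at h
    rw [AffineSubspace.direction_mk']
    simp at h
    omega
  · rw [AffineSubspace.mem_mk', vsub_eq_sub, LinearMap.mem_ker, map_sub, hl, hl, hμS x hx,
      hξS x hx, sub_self]

end Fibration

end CalabiYauTorus

open CalabiYauTorus in
theorem theorem3
    {k : ℕ}
    {E : Type*} [NormedAddCommGroup E] [NormedSpace ℂ E] [FiniteDimensional ℂ E]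
    (hE : Module.finrank ℂ E = k + 1)
    {M : Type*} [TopologicalSpace M] [T2Space M] [SecondCountableTopology M]
    [ChartedSpace E M] [IsManifold 𝓘(ℂ, E) ω M]
    (κ : (x : M) → TangentSpace 𝓘(ℝ, E) x [⋀^Fin 2]→L[ℝ] ℝ) (hκ : IsKahlerForm κ)
    (φ : (x : M) → TangentSpace 𝓘(ℂ, E) x [⋀^Fin (k + 1)]→L[ℂ] ℂ)
    (hφ : IsHolomorphicVolumeForm φ)
    [MulAction (Torus k) M] (hsmooth : IsSmoothAction k E M)
    (hpres : IsStructurePreserving k κ φ)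
    (μ : M → Module.Dual ℝ (Fin k → ℝ)) (hμ : IsMomentMap κ μ)
    (hH1 : H1Vanishes E M)
    (b : Module.Basis (Fin k) ℝ (Fin k → ℝ))
    {r : ℕ} (S : Fin r → Set M)
    (hS : nonRegularSet k E M = ⋃ i, S i)
    (hSconn : ∀ i, IsConnected (S i))
    (hSsub : ∀ i, ∃ d : ℕ, IsSubmanifold (E := E) d (S i))
    (hSstab : ∀ i, HasPosDimStabilizer k (S i)) :
    (∃ f : M → ℂ, IsPotential (E := E) b φ f) ∧
    ∀ f : M → ℂ, IsPotential (E := E) b φ f →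
      ∃ H : Set (AffineSubspace ℝ (Fin (k + 1) → ℝ)),
        H.Finite ∧ (∀ Q ∈ H, IsCodimTwoPlane Q) ∧
        ∀ p : Fin (k + 1) → ℝ, (∀ Q ∈ H, p ∉ Q) →
          IsSpecialLagrangian κ φ (fibrationMap b μ f ⁻¹' {p}) := by
  refine ⟨exists_isPotential hE hκ hφ hsmooth hpres hμ hH1, fun f hf => ?_⟩
  have hplane : ∀ i, ∃ Q : AffineSubspace ℝ (Fin (k + 1) → ℝ), IsCodimTwoPlane Q ∧
      ∀ x ∈ S i, fibrationMap b μ f x ∈ Q := fun i =>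
    (hSsub i).elim fun _ hd => exists_isCodimTwoPlane hsmooth hμ hf
      (hS ▸ Set.subset_iUnion S i) (hSconn i) hd (hSstab i)
  choose Q hQ hQS using hplane
  -- One plane per stratum: a non-regular point in the fiber over `p` would put `p` on one of them.
  refine ⟨Set.range Q, Set.finite_range Q, ?_, fun p hp => ?_⟩
  · rintro _ ⟨i, rfl⟩
    exact hQ i
  · refine isSpecialLagrangian_fiber hsmooth hμ hf hE hφ hκ hpres fun x hx hN => ?_
    rw [hS, Set.mem_iUnion] at hN
    obtain ⟨i, hi⟩ := hN
    exact hp (Q i) ⟨i, rfl⟩ (hx ▸ hQS i x hi)
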